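/- Let $(W,S)$ be a Coxeter system with length function $\ell$, let $\bar S$ be the set of $W$-conjugacy classes of elements of $S$ (identify two elements of $S$ when they are conjugate in $W$), let $\mathbb Z[\bar S]$ be the free abelian group on $\bar S$, let $\Gamma$ be a totally ordered abelian group and let $\varphi:\bar S\to\Gamma$ be a map, extended to a group morphism $\varphi:\mathbb Z[\bar S]\to\Gamma$. Write $\mathbb Z[\Gamma]=\bigoplus_\gamma\mathbb Z e^\gamma$ and let $\mathcal H=\mathcal H(W,S,\varphi)$ be the Hecke algebra: the free $\mathbb Z[\Gamma]$-module with basis $(T_w)_{w\in W}$ and the $\mathbb Z[\Gamma]$-bilinear associative multiplication with $T_wT_{w'}=T_{ww'}$ if $\ell(ww')=\ell(w)+\ell(w')$ and $(T_s-e^{\varphi(s)})(T_s+e^{-\varphi(s)})=0$ for $s\in S$. Let $h\mapsto\bar h$ be its antilinear involution with $\overline{e^\gamma}=e^{-\gamma}$, $\overline{T_w}=T_{w^{-1}}^{-1}$, and let $(C_w^\varphi)_{w\in W}$ be the Kazhdan–Lusztig basis: $C_w^\varphi$ is the unique element with $\overline{C_w^\varphi}=C_w^\varphi$ and $C_w^\varphi\equiv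 T_w$ modulo $\bigoplus_{y}\mathbb Z[\Gamma_{<0}]T_y$. For $?\in\{L,R,LR\}$ let $\leq_?^\varphi$ be the transitive closure of the relation "$C_x^\varphi$ has non-zero coefficient in $hC_y^\varphi$ (if $?=L$), in $C_y^\varphi h$ (if $?=R$), in $hC_y^\varphi$ or $C_y^\varphi h$ (if $?=LR$), for some $h\in\mathcal H$" between $x$ and $y$; let $\sim_?^\varphi$ be the associated equivalence relation and $\mathrm{Cell}_?^\varphi(w)=\{x\in W: x\sim_?^\varphi w\}$. For a cell $C$ of $\sim_?^\varphi$ let $$M_C^{?,\varphi}=\Big(\bigoplus_{x\leq_?^\varphi C}\mathbb Z[\Gamma]C_x^\varphi\Big)\Big/\Big(\bigoplus_{x<_?^\varphi C}\mathbb Z[\Gamma]C_x^\varphi\Big),\qquad \mathbb ZM_C^{?,\varphi}=\mathbb Z\otimes_{\mathbb Z[\Gamma]}M_C^{?,\varphi},$$ the tensor product being taken along the augmentation $e^\gamma\mapsto1$. Multiplication by $T_w$ makes $\mathbb ZM_C^{?,\varphi}$ a left $\mathbb ZW$-module if $?=L$, a right $\mathbb ZW$-module if $?=R$ and a $(\mathbb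 ZW,\mathbb ZW)$-bimodule if $?=LR$. A subset $X$ of $\mathbb Z[\bar S]$ is positive if $X\cup(-X)=\mathbb Z[\bar S]$, $X+X\subseteq X$ and $X\cap(-X)$ is a subgroup. For such $X$ let $\Gamma_X=\mathbb Z[\bar S]/(X\cap -X)$, totally ordered by $\gamma\leq_X\gamma'$ if and only if some representative of $\gamma'-\gamma$ lies in $X$, and let $\varphi_X:\bar S\to\Gamma_X$ be the canonical map. An example is $\mathrm{Pos}(\varphi)=\{\lambda\in\mathbb Z[\bar S]:\varphi(\lambda)\geq0\}$. Let $X=\mathrm{Pos}(\varphi)$. Then, for each $?\in\{L,R,LR\}$: (a) the relations $\leq_?^{\varphi}$ and $\leq_?^{\varphi_X}$ are equal, and the relations $\sim_?^{\varphi}$ and $\sim_?^{\varphi_X}$ are equal; (b) $\mathrm{Cell}_?^{\varphi}(w)=\mathrm{Cell}_?^{\varphi_X}(w)$ for all $w\in W$; (c) if $w\in W$ and $C=\mathrm{Cell}_?^{\varphi}(w)$, then $\mathbb ZM_C^{?,\varphi}\simeq\mathbb ZM_C^{?,\varphi_X}$ as left $\mathbb ZW$-modules (if $?=L$), right $\mathbb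 ZW$-modules (if $?=R$), $(\mathbb ZW,\mathbb ZW)$-bimodules (if $?=LR$). Consequently the preorders, the equivalence relations and the cells depend only on $\mathrm{Pos}(\varphi)$: if $\varphi':\bar S\to\Gamma'$ is a map to another totally ordered abelian group with $\mathrm{Pos}(\varphi')=\mathrm{Pos}(\varphi)$, then $\leq_?^{\varphi'}$ equals $\leq_?^{\varphi}$, $\sim_?^{\varphi'}$ equals $\sim_?^{\varphi}$, and $\mathrm{Cell}_?^{\varphi'}(w)=\mathrm{Cell}_?^{\varphi}(w)$ for all $w\in W$. -/

import Mathlib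

open scoped MulOpposite

noncomputable section

namespace KLCells

/-! ## Coxeter groups: the exchange condition for simple reflections -/

section Exchange

variable {B W : Type*} [Group W] {M : CoxeterMatrix B} (cs : CoxeterSystem M W)

open scoped Classical in
def signStep (i : B) : Function.End (W × ZMod 2) := fun p =>
  (cs.simple i * p.1 * cs.simple i, p.2 + if p.1 = cs.simple i then 1 else 0)

open scoped Classical in
theorem signStep_prod (ω : List B) (p : W × ZMod 2) :
    (ω.map (signStep cs)).prod p =
      (cs.wordProd ω * p.1 * (cs.wordProd ω)⁻¹,
        p.2 + ((cs.rightInvSeq ω).count p.1 : ZMod 2)) := by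
  induction ω with
  | nil => simp [Function.End.one_def]
  | cons i ω ih =>
    rw [List.map_cons, List.prod_cons]
    change signStep cs i ((ω.map (signStep cs)).prod p) = _
    rw [ih]
    have h : (cs.wordProd ω * p.1 * (cs.wordProd ω)⁻¹ = cs.simple i) ↔
        (cs.wordProd ω)⁻¹ * cs.simple i * cs.wordProd ω = p.1 := by
      constructor
      · intro h; rw [← h]; group
      · intro h; rw [← h]; group
    simp only [mul_assoc] at h
    simp only [signStep, cs.wordProd_cons, CoxeterSystem.rightInvSeq, List.count_cons, h,
      mul_inv_rev, cs.inv_simple, mul_assoc, beq_iff_eq, Nat.cast_add, add_assoc,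
      Nat.cast_ite, Nat.cast_one, Nat.cast_zero]

theorem alternatingWord_flatten (i j : B) (m : ℕ) :
    CoxeterSystem.alternatingWord i j (2 * m) = (List.replicate m [i, j]).flatten := by
  induction m with
  | zero => rfl
  | succ m ih =>
    rw [show 2 * (m + 1) = 2 * m + 1 + 1 by ring, CoxeterSystem.alternatingWord_succ',
      CoxeterSystem.alternatingWord_succ', ih]
    simp [List.replicate_succ]

open scoped Classical in
theorem signStep_liftable : M.IsLiftable (signStep cs) := by
  intro i j
  set m := M i j with hm
  set ω := CoxeterSystem.alternatingWord i j (2 * m) with hω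
  have h1 : (signStep cs i * signStep cs j) ^ m = (ω.map (signStep cs)).prod := by
    rw [hω, alternatingWord_flatten, List.map_flatten, List.prod_flatten]
    simp
  have hp : cs.wordProd ω = 1 := by
    rw [hω, cs.prod_alternatingWord_eq_mul_pow]
    simp [hm]
  have hcount : ∀ t, (((cs.rightInvSeq ω).count t : ℕ) : ZMod 2) = 0 := by
    intro t
    have hrev : ω.reverse = CoxeterSystem.alternatingWord j i (2 * m) := by
      rw [hω, alternatingWord_flatten, alternatingWord_flatten, List.reverse_flatten]
      simp
    have hr : (cs.rightInvSeq ω).count t = (cs.leftInvSeq ω.reverse).count t := by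
      rw [cs.leftInvSeq_reverse, List.count_reverse]
    rw [hr, hrev]
    set L := cs.leftInvSeq (CoxeterSystem.alternatingWord j i (2 * m)) with hL
    have hlen : L.length = 2 * m := by simp [hL]
    have hhalf : L.drop m = L.take m := by
      apply List.ext_getElem
      · simp [hlen]; omega
      · intro k h1 h2
        simp only [List.length_drop, hlen] at h1
        rw [List.getElem_drop, List.getElem_take]
        simp only [hL]
        rw [cs.getElem_leftInvSeq_alternatingWord j i m (m + k) (by omega),
          cs.getElem_leftInvSeq_alternatingWord j i m k (by omega),
          cs.prod_alternatingWord_eq_mul_pow, cs.prod_alternatingWord_eq_mul_pow]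
        have e1 : (2 * (m + k) + 1) / 2 = m + k := by omega
        have e2 : (2 * k + 1) / 2 = k := by omega
        rw [e1, e2, pow_add, hm, cs.simple_mul_simple_pow, one_mul]
        simp
    rw [← List.take_append_drop m L, hhalf, List.count_append, Nat.cast_add]
    exact CharTwo.add_self_eq_zero _
  rw [h1]
  funext p
  rw [signStep_prod, hp, hcount]
  simp [Function.End.one_def]

/-- If `w = π ω` and `ℓ(w s) < ℓ(w)`, then `s` occurs in the right inversion
sequence of `ω`. -/
theorem mem_rightInvSeq_of_isRightDescent {ω : List B} {j : B}
    (h : cs.length (cs.wordProd ω * cs.simple j) < cs.length (cs.wordProd ω)) :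
    cs.simple j ∈ cs.rightInvSeq ω := by
  classical
  obtain ⟨ω', hr', hw'⟩ := cs.exists_isReduced (cs.wordProd ω * cs.simple j)
  have hw : cs.wordProd (ω'.concat j) = cs.wordProd ω := by
    rw [cs.wordProd_concat, ← hw', mul_assoc, cs.simple_mul_simple_self, mul_one]
  have hred : cs.IsReduced (ω'.concat j) := by
    have h1 := hr'.eq
    rw [← hw'] at h1
    have h2 := cs.length_mul_simple (cs.wordProd ω) j
    unfold CoxeterSystem.IsReduced
    rw [hw, List.length_concat]
    omega
  have key : ∀ ω₁ ω₂ : List B, cs.wordProd ω₁ = cs.wordProd ω₂ →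
      (((cs.rightInvSeq ω₁).count (cs.simple j) : ℕ) : ZMod 2) =
        ((cs.rightInvSeq ω₂).count (cs.simple j) : ℕ) := by
    intro ω₁ ω₂ h12
    have hl : ∀ ω : List B, cs.lift ⟨signStep cs, signStep_liftable cs⟩ (cs.wordProd ω) =
        (ω.map (signStep cs)).prod := by
      intro ω
      rw [CoxeterSystem.wordProd, map_list_prod, List.map_map]
      congr 1
      apply List.map_congr_left
      intro i _
      simp
    have h3 := congrArg (fun f : Function.End (W × ZMod 2) => (f (cs.simple j, 0)).2)
      ((hl ω₁).symm.trans ((congrArg _ h12).trans (hl ω₂)))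
    simpa [signStep_prod] using h3
  have h1 : (cs.rightInvSeq (ω'.concat j)).count (cs.simple j) = 1 := by
    apply List.count_eq_one_of_mem hred.nodup_rightInvSeq
    rw [cs.rightInvSeq_concat]
    simp
  have h2 := key _ _ hw
  rw [h1] at h2
  by_contra hn
  rw [List.count_eq_zero_of_not_mem hn] at h2
  simp at h2

theorem exchange_up {w : W} {i j : B}
    (h1 : cs.length w < cs.length (cs.simple i * w))
    (h2 : cs.length w < cs.length (w * cs.simple j))
    (h3 : cs.length (cs.simple i * w * cs.simple j) < cs.length (cs.simple i * w)) :
    cs.simple i * w = w * cs.simple j := by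
  obtain ⟨ω, hr, rfl⟩ := cs.exists_isReduced w
  have hred : cs.IsReduced (i :: ω) := by
    have := cs.length_simple_mul (cs.wordProd ω) i
    have := hr.eq
    unfold CoxeterSystem.IsReduced
    rw [cs.wordProd_cons, List.length_cons]
    omega
  rw [← cs.wordProd_cons] at h3
  have hm := mem_rightInvSeq_of_isRightDescent cs h3
  rw [CoxeterSystem.rightInvSeq, List.mem_cons] at hm
  rcases hm with hm | hm
  · rw [hm]; group
  · have := (cs.isRightInversion_of_mem_rightInvSeq hr hm).2
    omega

theorem exchange_iff {w : W} {i j : B} (h : cs.simple i * w ≠ w * cs.simple j) :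
    (cs.length (cs.simple i * w * cs.simple j) < cs.length (cs.simple i * w) ↔
        cs.length (w * cs.simple j) < cs.length w) ∧
      (cs.length (cs.simple i * w * cs.simple j) < cs.length (w * cs.simple j) ↔
        cs.length (cs.simple i * w) < cs.length w) := by
  have e1 := cs.length_simple_mul w i
  have e2 := cs.length_mul_simple w j
  have e3 := cs.length_mul_simple (cs.simple i * w) j
  have e4 := cs.length_simple_mul (w * cs.simple j) i
  rw [← mul_assoc] at e4
  have k1 := exchange_up cs (w := w) (i := i) (j := j)
  have k2 := exchange_up cs (w := cs.simple i * w) (i := i) (j := j)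
  rw [cs.simple_mul_simple_cancel_left] at k2
  have k3 : ¬ (w = cs.simple i * w * cs.simple j) := by
    intro hh
    apply h
    conv_rhs => rw [hh]
    rw [cs.simple_mul_simple_cancel_right]
  have k1' := fun a b c => h (k1 a b c)
  have k2' := fun a b c => k3 (k2 a b c)
  constructor <;> constructor <;> intro hh <;> by_contra hc
  all_goals
    first
      | exact k1' (by omega) (by omega) (by omega)
      | exact k2' (by omega) (by omega) (by omega)

end Exchange

/-! ## Iwahori-Hecke algebras -/

section SBar

variable {B W : Type*} [Group W] {M : CoxeterMatrix B}

/-- Two simple reflections are identified when they are conjugate in `W`. -/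
def simpleConj (cs : CoxeterSystem M W) : Setoid B where
  r i j := IsConj (cs.simple i) (cs.simple j)
  iseqv := ⟨fun _ => IsConj.refl _, IsConj.symm, IsConj.trans⟩

/-- The set `S̄` of conjugacy classes of simple reflections. -/
def SBar (cs : CoxeterSystem M W) : Type _ := Quotient (simpleConj cs)

/-- The class in `S̄` of a simple reflection. -/
def toSBar (cs : CoxeterSystem M W) (i : B) : SBar cs := Quotient.mk (simpleConj cs) i

theorem toSBar_eq (cs : CoxeterSystem M W) {i j : B} (h : IsConj (cs.simple i) (cs.simple j)) :
    toSBar cs i = toSBar cs j := Quotient.sound h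

end SBar

section Hecke

variable {B W : Type*} [Group W] {M : CoxeterMatrix B} {A : Type*} [CommRing A]

/-- The Iwahori-Hecke algebra over a commutative ring `A`, in normalised form: the free
`A`-module with basis `(T_w)` and multiplication such that `T_w T_{w'} = T_{ww'}` whenever
`ℓ(ww') = ℓ(w) + ℓ(w')` and `T_s ^ 2 = 1 + u(s) T_s`
(see `GHecke.T_mul_T` and `GHecke.T_simple_sq` below). -/
@[nolint unusedArguments]
def GHecke (cs : CoxeterSystem M W) (_u : SBar cs → A) : Type _ := W →₀ A

namespace GHecke

variable (cs : CoxeterSystem M W) (u : SBar cs → A)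

instance : AddCommGroup (GHecke cs u) := inferInstanceAs (AddCommGroup (W →₀ A))
instance : Module A (GHecke cs u) := inferInstanceAs (Module A (W →₀ A))

/-- The standard basis `(T_w)`. -/
def basis : Module.Basis W A (GHecke cs u) := Module.Basis.ofRepr (LinearEquiv.refl A (W →₀ A))

/-- The standard basis element `T_w`. -/
def T (w : W) : GHecke cs u := basis cs u w

open scoped Classical in
/-- Left multiplication by `T_s`. -/
def lop (i : B) : GHecke cs u →ₗ[A] GHecke cs u :=
  (basis cs u).constr A fun w => T cs u (cs.simple i * w) +
    (if cs.length (cs.simple i * w) < cs.length w then u (toSBar cs i) else 0) • T cs u w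

open scoped Classical in
/-- Right multiplication by `T_s`. -/
def rop (i : B) : GHecke cs u →ₗ[A] GHecke cs u :=
  (basis cs u).constr A fun w => T cs u (w * cs.simple i) +
    (if cs.length (w * cs.simple i) < cs.length w then u (toSBar cs i) else 0) • T cs u w

theorem lop_T (i : B) (w : W) : lop cs u i (T cs u w) = T cs u (cs.simple i * w) +
    (if cs.length (cs.simple i * w) < cs.length w then u (toSBar cs i) else 0) • T cs u w := by
  simp [lop, T, Module.Basis.constr_basis]

theorem rop_T (i : B) (w : W) : rop cs u i (T cs u w) = T cs u (w * cs.simple i) +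
    (if cs.length (w * cs.simple i) < cs.length w then u (toSBar cs i) else 0) • T cs u w := by
  simp [rop, T, Module.Basis.constr_basis]

theorem lop_rop (i j : B) : lop cs u i * rop cs u j = rop cs u j * lop cs u i := by
  apply (basis cs u).ext
  intro w
  change lop cs u i (rop cs u j (T cs u w)) = rop cs u j (lop cs u i (T cs u w))
  rw [rop_T, lop_T, map_add, map_add, map_smul, map_smul, lop_T, rop_T, lop_T, rop_T]
  by_cases h : cs.simple i * w = w * cs.simple j
  · have hc : toSBar cs i = toSBar cs j := by
      apply toSBar_eq
      rw [isConj_iff]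
      refine ⟨w⁻¹, ?_⟩
      rw [inv_inv, mul_assoc, h, inv_mul_cancel_left]
    have h' : cs.simple i * (w * cs.simple j) = w := by
      rw [← h, cs.simple_mul_simple_cancel_left]
    have h'' : w * cs.simple j * cs.simple j = w := cs.simple_mul_simple_cancel_right j
    rw [h, h', h'', hc]
  · obtain ⟨h1, h2⟩ := exchange_iff cs h
    rw [← mul_assoc]
    simp only [h1, h2]
    simp only [smul_add, smul_smul, mul_comm]
    abel

theorem lop_iter (ω : List B) (h : cs.IsReduced ω) :
    (ω.map (lop cs u)).prod (T cs u 1) = T cs u (cs.wordProd ω) := by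
  induction ω with
  | nil => simp
  | cons i ω ih =>
    have hr : cs.IsReduced ω := by simpa using h.drop 1
    have h1 := h.eq
    have h2 := hr.eq
    rw [cs.wordProd_cons, List.length_cons] at h1
    rw [List.map_cons, List.prod_cons, Module.End.mul_apply, ih hr, lop_T, if_neg (by omega),
      cs.wordProd_cons, zero_smul, add_zero]

theorem rop_iter (w : W) : ∃ f ∈ Submonoid.closure (Set.range (rop cs u)),
    f (T cs u 1) = T cs u w := by
  generalize hn : cs.length w = n
  induction n generalizing w with
  | zero =>
    rw [cs.length_eq_zero_iff] at hn
    exact ⟨1, one_mem _, by simp [hn]⟩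
  | succ n ih =>
    obtain ⟨i, hi⟩ := cs.exists_rightDescent_of_ne_one (w := w)
      (by rw [Ne, ← cs.length_eq_zero_iff]; omega)
    rw [cs.isRightDescent_iff] at hi
    obtain ⟨f, hf, h⟩ := ih (w * cs.simple i) (by omega)
    refine ⟨rop cs u i * f, mul_mem (Submonoid.subset_closure ⟨i, rfl⟩) hf, ?_⟩
    rw [Module.End.mul_apply, h, rop_T, cs.simple_mul_simple_cancel_right, if_neg (by omega),
      zero_smul, add_zero]

/-- Endomorphisms commuting with all right multiplications by `T_s`. -/
def comm : Subalgebra A (Module.End A (GHecke cs u)) :=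
  Subalgebra.centralizer A (Set.range (rop cs u))

theorem lop_mem (i : B) : lop cs u i ∈ comm cs u := by
  rw [comm, Subalgebra.mem_centralizer_iff]
  rintro _ ⟨j, rfl⟩
  exact (lop_rop cs u i j).symm

theorem comm_closure {f g : Module.End A (GHecke cs u)} (hf : f ∈ comm cs u)
    (hg : g ∈ Submonoid.closure (Set.range (rop cs u))) : g * f = f * g := by
  induction hg using Submonoid.closure_induction with
  | mem x hx => exact (Subalgebra.mem_centralizer_iff A).1 hf x hx
  | one => simp
  | mul x y _ _ hx hy => rw [mul_assoc, hy, ← mul_assoc, hx, mul_assoc]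

/-- Evaluation at `T_1`. -/
def evalOne : comm cs u →ₗ[A] GHecke cs u :=
  (LinearMap.applyₗ (T cs u 1)).comp (comm cs u).val.toLinearMap

theorem evalOne_apply (f : comm cs u) : evalOne cs u f = f.1 (T cs u 1) := rfl

theorem evalOne_bijective : Function.Bijective (evalOne cs u) := by
  constructor
  · rw [← LinearMap.ker_eq_bot, LinearMap.ker_eq_bot']
    intro f hf
    apply Subtype.ext
    apply (basis cs u).ext
    intro w
    obtain ⟨g, hg, h⟩ := rop_iter cs u w
    change f.1 (T cs u w) = 0
    rw [← h, ← Module.End.mul_apply, ← comm_closure cs u f.2 hg, Module.End.mul_apply,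
      ← evalOne_apply, hf, map_zero]
  · rw [← LinearMap.range_eq_top, eq_top_iff, ← (basis cs u).span_eq, Submodule.span_le]
    rintro _ ⟨w, rfl⟩
    obtain ⟨ω, hr, rfl⟩ := cs.exists_isReduced w
    refine ⟨⟨(ω.map (lop cs u)).prod, ?_⟩, lop_iter cs u ω hr⟩
    apply list_prod_mem
    simp only [List.mem_map]
    rintro _ ⟨i, _, rfl⟩
    exact lop_mem cs u i

/-- An element `h` corresponds to the operator of left multiplication by `h`. -/
def equivComm : comm cs u ≃ₗ[A] GHecke cs u :=
  LinearEquiv.ofBijective (evalOne cs u) (evalOne_bijective cs u)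

/-- Left multiplication by `h`. -/
def mulOp (h : GHecke cs u) : Module.End A (GHecke cs u) := ((equivComm cs u).symm h).1

theorem mulOp_T_one (h : GHecke cs u) : mulOp cs u h (T cs u 1) = h :=
  (equivComm cs u).apply_symm_apply h

theorem mulOp_unique {f : Module.End A (GHecke cs u)} (hf : f ∈ comm cs u) :
    mulOp cs u (f (T cs u 1)) = f := by
  have : (equivComm cs u).symm (f (T cs u 1)) = ⟨f, hf⟩ := by
    rw [LinearEquiv.symm_apply_eq]; rfl
  rw [mulOp, this]

theorem mulOp_mem (h : GHecke cs u) : mulOp cs u h ∈ comm cs u := ((equivComm cs u).symm h).2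

theorem mulOp_mulOp (x y : GHecke cs u) :
    mulOp cs u (mulOp cs u x y) = mulOp cs u x * mulOp cs u y := by
  have := mulOp_unique cs u (mul_mem (mulOp_mem cs u x) (mulOp_mem cs u y))
  rwa [Module.End.mul_apply, mulOp_T_one] at this

theorem mulOp_add (x y : GHecke cs u) : mulOp cs u (x + y) = mulOp cs u x + mulOp cs u y := by
  simp [mulOp]

theorem mulOp_smul (a : A) (x : GHecke cs u) : mulOp cs u (a • x) = a • mulOp cs u x := by
  simp [mulOp]

theorem mulOp_one : mulOp cs u (T cs u 1) = 1 := by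
  simpa using mulOp_unique cs u (one_mem (comm cs u))

instance : Ring (GHecke cs u) :=
  { (inferInstance : AddCommGroup (GHecke cs u)) with
    mul := fun x y => mulOp cs u x y
    one := T cs u 1
    mul_assoc := fun x y z => by
      change mulOp cs u (mulOp cs u x y) z = mulOp cs u x (mulOp cs u y z)
      rw [mulOp_mulOp]; rfl
    one_mul := fun x => by
      change mulOp cs u (T cs u 1) x = x
      rw [mulOp_one]; rfl
    mul_one := fun x => mulOp_T_one cs u x
    left_distrib := fun x y z => map_add (mulOp cs u x) y z
    right_distrib := fun x y z => by
      change mulOp cs u (x + y) z = mulOp cs u x z + mulOp cs u y z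
      rw [mulOp_add]; rfl
    zero_mul := fun x => by
      change mulOp cs u 0 x = 0
      simp [mulOp]
    mul_zero := fun x => map_zero (mulOp cs u x) }

theorem mul_def (x y : GHecke cs u) : x * y = mulOp cs u x y := rfl

theorem one_def : (1 : GHecke cs u) = T cs u 1 := rfl

instance : Algebra A (GHecke cs u) :=
  Algebra.ofModule
    (fun a x y => by rw [mul_def, mulOp_smul]; rfl)
    (fun a x y => by rw [mul_def, map_smul]; rfl)

theorem mulOp_simple (i : B) : mulOp cs u (T cs u (cs.simple i)) = lop cs u i := by
  have h := mulOp_unique cs u (lop_mem cs u i)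
  rwa [lop_T, mul_one, if_neg (by simp), zero_smul, add_zero] at h

theorem T_simple_mul (i : B) (x : GHecke cs u) : T cs u (cs.simple i) * x = lop cs u i x := by
  rw [mul_def, mulOp_simple]

theorem mul_T_simple (i : B) (x : GHecke cs u) : x * T cs u (cs.simple i) = rop cs u i x := by
  have h : rop cs u i (T cs u 1) = T cs u (cs.simple i) := by
    rw [rop_T, one_mul, if_neg (by simp), zero_smul, add_zero]
  rw [← h, mul_def]
  have h2 := (Subalgebra.mem_centralizer_iff A).1 (mulOp_mem cs u x) _ ⟨i, rfl⟩
  have h3 := LinearMap.congr_fun h2 (T cs u 1)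
  simp only [Module.End.mul_apply, mulOp_T_one] at h3
  exact h3.symm

theorem T_one : T cs u 1 = 1 := rfl

theorem T_simple_mul_T (i : B) (w : W) : T cs u (cs.simple i) * T cs u w =
    T cs u (cs.simple i * w) +
    (if cs.length (cs.simple i * w) < cs.length w then u (toSBar cs i) else 0) • T cs u w := by
  rw [T_simple_mul, lop_T]

theorem T_simple_mul_T_of_lt {i : B} {w : W} (h : cs.length w < cs.length (cs.simple i * w)) :
    T cs u (cs.simple i) * T cs u w = T cs u (cs.simple i * w) := by
  rw [T_simple_mul_T, if_neg (by omega), zero_smul, add_zero]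

theorem T_simple_sq (i : B) :
    T cs u (cs.simple i) * T cs u (cs.simple i) = 1 + u (toSBar cs i) • T cs u (cs.simple i) := by
  rw [T_simple_mul_T, cs.simple_mul_simple_self, if_pos (by simp)]; rfl

theorem T_mul_T (x y : W) (h : cs.length (x * y) = cs.length x + cs.length y) :
    T cs u x * T cs u y = T cs u (x * y) := by
  generalize hn : cs.length x = n
  induction n generalizing x with
  | zero =>
    rw [cs.length_eq_zero_iff] at hn
    simp [hn, T_one]
  | succ n ih =>
    obtain ⟨i, hi⟩ := cs.exists_leftDescent_of_ne_one (w := x)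
      (by rw [Ne, ← cs.length_eq_zero_iff]; omega)
    rw [cs.isLeftDescent_iff] at hi
    have e1 := cs.length_mul_le (cs.simple i * x) y
    have e2 := cs.length_simple_mul (x * y) i
    rw [← mul_assoc] at e2
    have h1 := ih (cs.simple i * x) (by omega) (by omega)
    have h2 : T cs u (cs.simple i) * T cs u (cs.simple i * x) = T cs u x := by
      rw [T_simple_mul_T_of_lt, cs.simple_mul_simple_cancel_left]
      rw [cs.simple_mul_simple_cancel_left]; omega
    rw [← h2, mul_assoc, h1, mul_assoc, T_simple_mul_T_of_lt, cs.simple_mul_simple_cancel_left]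
    rw [cs.simple_mul_simple_cancel_left, ← mul_assoc]; omega

end GHecke

end Hecke

/-! ## Kazhdan-Lusztig bases -/

section KL

variable {B W : Type*} [Group W] {M : CoxeterMatrix B} {Γ : Type*} [AddCommGroup Γ]

/-- The element `e^γ` of the group ring `ℤ[Γ]`. -/
def expo (γ : Γ) : AddMonoidAlgebra ℤ Γ := AddMonoidAlgebra.single γ 1

theorem expo_mul_expo (γ δ : Γ) : expo γ * expo δ = expo (γ + δ) := by
  simp [expo, AddMonoidAlgebra.single_mul_single]

theorem expo_zero : expo (0 : Γ) = 1 := rfl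

/-- The involution `e^γ ↦ e^(-γ)` of `ℤ[Γ]`. -/
def conj : AddMonoidAlgebra ℤ Γ →+* AddMonoidAlgebra ℤ Γ :=
  AddMonoidAlgebra.mapDomainRingHom ℤ (negAddMonoidHom : Γ →+ Γ)

theorem conj_single (γ : Γ) (n : ℤ) :
    conj (AddMonoidAlgebra.single γ n) = AddMonoidAlgebra.single (-γ) n := by
  simp [conj]

theorem conj_expo (γ : Γ) : conj (expo γ) = expo (-γ) := conj_single γ 1

/-- The Hecke algebra of `(W, S)` over `ℤ[Γ]` with parameter `φ : S̄ → Γ`: free with basis `(T_w)`,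
with `T_w T_{w'} = T_{ww'}` if `ℓ(ww') = ℓ(w) + ℓ(w')` (`GHecke.T_mul_T`) and
`(T_s - e^{φ(s)}) (T_s + e^{-φ(s)}) = 0` (`Hecke.quadratic`). -/
abbrev Hecke (cs : CoxeterSystem M W) (φ : SBar cs → Γ) : Type _ :=
  GHecke cs (fun ω => expo (φ ω) - expo (-φ ω))

namespace Hecke

variable (cs : CoxeterSystem M W) (φ : SBar cs → Γ)

/-- The standard basis of the Hecke algebra. -/
abbrev stdBasis : Module.Basis W (AddMonoidAlgebra ℤ Γ) (Hecke cs φ) := GHecke.basis cs _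

/-- The standard basis element `T_w`. -/
abbrev T (w : W) : Hecke cs φ := GHecke.T cs _ w

theorem stdBasis_apply (w : W) : stdBasis cs φ w = T cs φ w := rfl

theorem T_one : T cs φ 1 = 1 := rfl

theorem quadratic (i : B) :
    (T cs φ (cs.simple i) - algebraMap _ _ (expo (φ (toSBar cs i)))) *
      (T cs φ (cs.simple i) + algebraMap _ _ (expo (-φ (toSBar cs i)))) = 0 := by
  have h := GHecke.T_simple_sq cs (fun ω => expo (φ ω) - expo (-φ ω)) i
  rw [mul_add, sub_mul, sub_mul, h, ← map_mul, expo_mul_expo, add_neg_cancel, expo_zero, map_one,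
    ← Algebra.smul_def, ← Algebra.commutes, ← Algebra.smul_def, sub_smul]
  abel

theorem T_simple_inv (i : B) :
    T cs φ (cs.simple i) * (T cs φ (cs.simple i) -
      algebraMap _ _ (expo (φ (toSBar cs i)) - expo (-φ (toSBar cs i)))) = 1 ∧
    (T cs φ (cs.simple i) -
      algebraMap _ _ (expo (φ (toSBar cs i)) - expo (-φ (toSBar cs i)))) *
        T cs φ (cs.simple i) = 1 := by
  have h := GHecke.T_simple_sq cs (fun ω => expo (φ ω) - expo (-φ ω)) i
  constructor
  · rw [mul_sub, h, ← Algebra.commutes, ← Algebra.smul_def]; abel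
  · rw [sub_mul, h, ← Algebra.smul_def]; abel

theorem isUnit_T (w : W) : IsUnit (T cs φ w) := by
  generalize hn : cs.length w = n
  induction n generalizing w with
  | zero =>
    rw [cs.length_eq_zero_iff] at hn
    rw [hn]; exact isUnit_one
  | succ n ih =>
    obtain ⟨i, hi⟩ := cs.exists_leftDescent_of_ne_one (w := w)
      (by rw [Ne, ← cs.length_eq_zero_iff]; omega)
    rw [cs.isLeftDescent_iff] at hi
    have h2 : T cs φ (cs.simple i) * T cs φ (cs.simple i * w) = T cs φ w := by
      rw [GHecke.T_simple_mul_T_of_lt, cs.simple_mul_simple_cancel_left]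
      rw [cs.simple_mul_simple_cancel_left]; omega
    rw [← h2]
    have h3 := T_simple_inv cs φ i
    exact IsUnit.mul ⟨⟨_, _, h3.1, h3.2⟩, rfl⟩ (ih _ (by omega))

/-- The bar involution: `ℤ[Γ]`-antilinear, with `T_w ↦ T_{w⁻¹}⁻¹` (the elements `T_w` are
invertible by `isUnit_T`). -/
def bar (h : Hecke cs φ) : Hecke cs φ :=
  ((stdBasis cs φ).repr h).sum fun w a => conj a • Ring.inverse (T cs φ w⁻¹)

theorem bar_add (x y : Hecke cs φ) : bar cs φ (x + y) = bar cs φ x + bar cs φ y := by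
  rw [bar, map_add, Finsupp.sum_add_index']
  · rfl
  · simp
  · intro w a b; rw [map_add, add_smul]

/-- The bar involution as a morphism of additive groups. -/
def barHom : Hecke cs φ →+ Hecke cs φ := AddMonoidHom.mk' (bar cs φ) (bar_add cs φ)

theorem bar_smul (a : AddMonoidAlgebra ℤ Γ) (x : Hecke cs φ) :
    bar cs φ (a • x) = conj a • bar cs φ x := by
  rw [bar, map_smul, Finsupp.sum_smul_index (by simp), bar, Finsupp.smul_sum]
  apply Finsupp.sum_congr
  intro w _
  rw [map_mul, mul_smul]

theorem bar_T (w : W) : bar cs φ (T cs φ w) = Ring.inverse (T cs φ w⁻¹) := by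
  rw [bar, ← stdBasis_apply, Module.Basis.repr_self, Finsupp.sum_single_index (by simp)]
  simp

theorem bar_zero : bar cs φ 0 = 0 := map_zero (barHom cs φ)

theorem bar_sub (x y : Hecke cs φ) : bar cs φ (x - y) = bar cs φ x - bar cs φ y :=
  map_sub (barHom cs φ) x y

theorem bar_T_simple (i : B) : bar cs φ (T cs φ (cs.simple i)) =
    T cs φ (cs.simple i) - algebraMap _ _ (expo (φ (toSBar cs i)) - expo (-φ (toSBar cs i))) := by
  rw [bar_T, cs.inv_simple]
  have h3 := T_simple_inv cs φ i
  exact Ring.inverse_unit ⟨_, _, h3.1, h3.2⟩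

theorem bar_T_of_lt {i : B} {w : W} (h : cs.length w < cs.length (cs.simple i * w)) :
    bar cs φ (T cs φ (cs.simple i * w)) = bar cs φ (T cs φ (cs.simple i)) * bar cs φ (T cs φ w) := by
  rw [bar_T, bar_T, bar_T, cs.inv_simple, mul_inv_rev, cs.inv_simple]
  have h1 : T cs φ (w⁻¹ * cs.simple i) = T cs φ w⁻¹ * T cs φ (cs.simple i) := by
    rw [GHecke.T_mul_T]
    rw [cs.length_inv, cs.length_simple, ← cs.length_inv, mul_inv_rev, inv_inv, cs.inv_simple]
    have := cs.length_simple_mul w i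
    omega
  rw [h1]
  obtain ⟨a, ha⟩ := isUnit_T cs φ w⁻¹
  obtain ⟨b, hb⟩ := isUnit_T cs φ (cs.simple i)
  rw [← ha, ← hb, ← Units.val_mul, Ring.inverse_unit, Ring.inverse_unit, Ring.inverse_unit,
    mul_inv_rev, Units.val_mul]

/-- An additive map equality can be checked on multiples of the `T_w`. -/
theorem induct {p : Hecke cs φ → Prop} (h : Hecke cs φ) (h0 : p 0)
    (hadd : ∀ x y, p x → p y → p (x + y))
    (hT : ∀ w, (stdBasis cs φ).repr h w ≠ 0 →
      ∀ a : AddMonoidAlgebra ℤ Γ, p (a • T cs φ w)) : p h := by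
  rw [← (stdBasis cs φ).linearCombination_repr h, Finsupp.linearCombination_apply, Finsupp.sum]
  have : ∀ s : Finset W, s ⊆ ((stdBasis cs φ).repr h).support →
      p (∑ w ∈ s, (stdBasis cs φ).repr h w • stdBasis cs φ w) := by
    classical
    intro s
    induction s using Finset.induction_on with
    | empty => intro _; simpa using h0
    | insert w s hw ih =>
      intro hs
      rw [Finset.sum_insert hw]
      exact hadd _ _ (hT w (Finsupp.mem_support_iff.1 (hs (Finset.mem_insert_self w s))) _)
        (ih fun x hx => hs (Finset.mem_insert_of_mem hx))
  exact this _ (Finset.Subset.refl _)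

theorem conj_u (i : B) : conj (expo (φ (toSBar cs i)) - expo (-φ (toSBar cs i))) =
    -(expo (φ (toSBar cs i)) - expo (-φ (toSBar cs i))) := by
  rw [map_sub, conj_expo, conj_expo, neg_neg, neg_sub]

theorem bar_T_simple_mul (i : B) (h : Hecke cs φ) :
    bar cs φ (T cs φ (cs.simple i) * h) = bar cs φ (T cs φ (cs.simple i)) * bar cs φ h := by
  induction h using induct with
  | h0 => rw [mul_zero, bar_zero, mul_zero]
  | hadd x y hx hy => rw [mul_add, bar_add, bar_add, mul_add, hx, hy]
  | hT w _ a =>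
    rw [mul_smul_comm, bar_smul, bar_smul, mul_smul_comm]
    congr 1
    rcases cs.length_simple_mul w i with h | h
    · rw [GHecke.T_simple_mul_T_of_lt _ _ (by omega), bar_T_of_lt _ _ (by omega)]
    · have h1 := bar_T_of_lt cs φ (i := i) (w := cs.simple i * w)
        (by rw [cs.simple_mul_simple_cancel_left]; omega)
      rw [cs.simple_mul_simple_cancel_left] at h1
      rw [GHecke.T_simple_mul_T, if_pos (by omega), bar_add, bar_smul, conj_u, h1]
      set b := bar cs φ (T cs φ (cs.simple i * w))
      set u := expo (φ (toSBar cs i)) - expo (-φ (toSBar cs i)) with hu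
      have h2 := T_simple_inv cs φ i
      rw [← bar_T_simple] at h2
      have h3 : bar cs φ (T cs φ (cs.simple i)) * bar cs φ (T cs φ (cs.simple i)) =
          1 - u • bar cs φ (T cs φ (cs.simple i)) := by
        conv_lhs => rw [bar_T_simple, ← hu]; rhs; rw [← bar_T_simple]
        rw [sub_mul, h2.1, Algebra.smul_def]
      rw [← mul_assoc, h3, sub_mul, one_mul, neg_smul, smul_mul_assoc]
      abel

/-- The span of the `T_w` with `ℓ(w) < n`. -/
def low (n : ℕ) : Submodule (AddMonoidAlgebra ℤ Γ) (Hecke cs φ) where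
  carrier := {h | ∀ w, n ≤ cs.length w → (stdBasis cs φ).repr h w = 0}
  add_mem' := fun {x y} hx hy w hw => by rw [map_add, Finsupp.add_apply, hx w hw, hy w hw, add_zero]
  zero_mem' := fun w _ => by simp
  smul_mem' := fun a x hx w hw => by rw [map_smul, Finsupp.smul_apply, hx w hw, smul_zero]

theorem T_mem_low {w : W} {n : ℕ} (h : cs.length w < n) : T cs φ w ∈ low cs φ n := by
  classical
  intro y hy
  rw [← stdBasis_apply, Module.Basis.repr_self, Finsupp.single_apply, if_neg]
  rintro rfl
  omega

theorem low_mono {m n : ℕ} (h : m ≤ n) : low cs φ m ≤ low cs φ n :=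
  fun _ hx w hw => hx w (h.trans hw)

theorem low_induct {p : Hecke cs φ → Prop} {n : ℕ} {h : Hecke cs φ} (hh : h ∈ low cs φ n) (h0 : p 0)
    (hadd : ∀ x y, p x → p y → p (x + y))
    (hT : ∀ w, cs.length w < n → ∀ a : AddMonoidAlgebra ℤ Γ, p (a • T cs φ w)) : p h := by
  refine induct cs φ h h0 hadd fun w hw a => hT w ?_ a
  by_contra hc
  exact hw (hh w (by omega))

theorem simple_mul_low (i : B) {n : ℕ} {h : Hecke cs φ} (hh : h ∈ low cs φ n) :
    T cs φ (cs.simple i) * h ∈ low cs φ (n + 1) := by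
  refine low_induct cs φ (p := fun h => T cs φ (cs.simple i) * h ∈ low cs φ (n + 1)) hh
    (by simp) (fun x y hx hy => ?_) fun w hw a => ?_
  · rw [mul_add]; exact add_mem hx hy
  · rw [mul_smul_comm, GHecke.T_simple_mul_T]
    have := cs.length_simple_mul w i
    exact Submodule.smul_mem _ _ (add_mem (T_mem_low _ _ (by omega))
      (Submodule.smul_mem _ _ (T_mem_low _ _ (by omega))))

theorem bar_T_sub_mem (w : W) : bar cs φ (T cs φ w) - T cs φ w ∈ low cs φ (cs.length w) := by
  generalize hn : cs.length w = n
  induction n generalizing w with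
  | zero =>
    rw [cs.length_eq_zero_iff] at hn
    subst hn
    rw [bar_T, inv_one, T_one, Ring.inverse_one, sub_self]
    exact zero_mem _
  | succ n ih =>
    obtain ⟨i, hi⟩ := cs.exists_leftDescent_of_ne_one (w := w)
      (by rw [Ne, ← cs.length_eq_zero_iff]; omega)
    rw [cs.isLeftDescent_iff] at hi
    have h1 := bar_T_of_lt cs φ (i := i) (w := cs.simple i * w)
        (by rw [cs.simple_mul_simple_cancel_left]; omega)
    have h2 : T cs φ (cs.simple i) * T cs φ (cs.simple i * w) = T cs φ w := by
      rw [GHecke.T_simple_mul_T_of_lt, cs.simple_mul_simple_cancel_left]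
      rw [cs.simple_mul_simple_cancel_left]; omega
    rw [cs.simple_mul_simple_cancel_left, bar_T_simple] at h1
    have h3 := ih (cs.simple i * w) (by omega)
    set d := bar cs φ (T cs φ (cs.simple i * w)) - T cs φ (cs.simple i * w) with hd
    have h4 : bar cs φ (T cs φ (cs.simple i * w)) = T cs φ (cs.simple i * w) + d := by
      rw [hd]; abel
    rw [h1, h4, sub_mul, mul_add, h2, ← Algebra.smul_def]
    have h5 : T cs φ (cs.simple i * w) + d ∈ low cs φ (n + 1) :=
      add_mem (T_mem_low _ _ (by omega)) (low_mono cs φ (Nat.le_succ n) h3)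
    have h6 := sub_mem (simple_mul_low cs φ i h3)
      (Submodule.smul_mem _ (expo (φ (toSBar cs i)) - expo (-φ (toSBar cs i))) h5)
    convert h6 using 1
    abel

/-- Leading coefficients of a combination of a family that is unitriangular for the length. -/
theorem top_coeff (σ : AddMonoidAlgebra ℤ Γ →+ AddMonoidAlgebra ℤ Γ) (v : W → Hecke cs φ)
    (hv : ∀ w, v w - T cs φ w ∈ low cs φ (cs.length w)) (l : W →₀ AddMonoidAlgebra ℤ Γ) (w : W)
    (hl : ∀ y ∈ l.support, cs.length y ≤ cs.length w) :
    (stdBasis cs φ).repr (l.sum fun y a => σ a • v y) w = σ (l w) := by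
  classical
  rw [Finsupp.sum, map_sum, Finsupp.finsetSum_apply]
  have h : ∀ y ∈ l.support, (stdBasis cs φ).repr (σ (l y) • v y) w =
      if y = w then σ (l w) else 0 := by
    intro y hy
    have h1 := hv y w (hl y hy)
    rw [map_sub, Finsupp.sub_apply, sub_eq_zero, ← stdBasis_apply, Module.Basis.repr_self,
      Finsupp.single_apply] at h1
    rw [map_smul, Finsupp.smul_apply, h1]
    split_ifs with hyw
    · rw [hyw]; simp
    · simp
  rw [Finset.sum_congr rfl h, Finset.sum_ite_eq']
  split_ifs with hw
  · rfl
  · rw [Finsupp.notMem_support_iff.1 hw, map_zero]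

theorem exists_top (l : W →₀ AddMonoidAlgebra ℤ Γ) (hl : l ≠ 0) :
    ∃ w ∈ l.support, ∀ y ∈ l.support, cs.length y ≤ cs.length w :=
  Finset.exists_max_image l.support cs.length (Finsupp.support_nonempty_iff.2 hl)

/-- Existence of bar-invariant elements with leading term `T_w`. -/
theorem exists_bar_fixed (w : W) :
    ∃ h : Hecke cs φ, bar cs φ h = h ∧ h - T cs φ w ∈ low cs φ (cs.length w) := by
  generalize hn : cs.length w = n
  induction n generalizing w with
  | zero =>
    rw [cs.length_eq_zero_iff] at hn
    subst hn
    refine ⟨T cs φ 1, ?_, by simp⟩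
    rw [bar_T, inv_one, T_one, Ring.inverse_one]
  | succ n ih =>
    obtain ⟨i, hi⟩ := cs.exists_leftDescent_of_ne_one (w := w)
      (by rw [Ne, ← cs.length_eq_zero_iff]; omega)
    rw [cs.isLeftDescent_iff] at hi
    obtain ⟨k, hk, hk'⟩ := ih (cs.simple i * w) (by omega)
    have h2 : T cs φ (cs.simple i) * T cs φ (cs.simple i * w) = T cs φ w := by
      rw [GHecke.T_simple_mul_T_of_lt, cs.simple_mul_simple_cancel_left]
      rw [cs.simple_mul_simple_cancel_left]; omega
    refine ⟨T cs φ (cs.simple i) * k + expo (-φ (toSBar cs i)) • k, ?_, ?_⟩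
    · rw [bar_add, bar_smul, bar_T_simple_mul, hk, conj_expo, neg_neg, bar_T_simple, sub_mul,
        ← Algebra.smul_def, sub_smul]
      abel
    · set d := k - T cs φ (cs.simple i * w) with hd
      have h4 : k = T cs φ (cs.simple i * w) + d := by rw [hd]; abel
      have h5 : k ∈ low cs φ (n + 1) := by
        rw [h4]
        exact add_mem (T_mem_low _ _ (by omega)) (low_mono cs φ (Nat.le_succ n) hk')
      have h6 := add_mem (simple_mul_low cs φ i hk') (Submodule.smul_mem _
        (expo (-φ (toSBar cs i))) h5)
      convert h6 using 1
      rw [hd, mul_sub, h2]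
      abel

variable [LinearOrder Γ]

/-- `ℤ[Γ_{<0}]`, the elements of `ℤ[Γ]` supported on the negative elements of `Γ`. -/
def negPart (Γ : Type*) [AddCommGroup Γ] [LinearOrder Γ] : AddSubgroup (AddMonoidAlgebra ℤ Γ) where
  carrier := {a | ∀ γ, a.coeff γ ≠ 0 → γ < 0}
  add_mem' := fun {a b} ha hb γ h => by
    by_contra hc
    have h1 : a.coeff γ = 0 := by by_contra h1; exact hc (ha γ h1)
    have h2 : b.coeff γ = 0 := by by_contra h2; exact hc (hb γ h2)
    exact h (by simp [h1, h2])
  zero_mem' := fun γ h => absurd rfl h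
  neg_mem' := fun {a} ha γ h => ha γ (by simpa using h)

/-- `ℋ_{<0} = ⨁_w ℤ[Γ_{<0}] T_w`. -/
def negHecke : AddSubgroup (Hecke cs φ) where
  carrier := {h | ∀ w, (stdBasis cs φ).repr h w ∈ negPart Γ}
  add_mem' := fun {x y} hx hy w => by rw [map_add]; exact add_mem (hx w) (hy w)
  zero_mem' := fun w => by rw [map_zero]; exact zero_mem _
  neg_mem' := fun {x} hx w => by rw [map_neg]; exact neg_mem (hx w)

theorem smul_T_mem_negHecke {a : AddMonoidAlgebra ℤ Γ} (ha : a ∈ negPart Γ) (w : W) :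
    a • T cs φ w ∈ negHecke cs φ := by
  classical
  intro y
  rw [map_smul, ← stdBasis_apply, Module.Basis.repr_self, Finsupp.smul_apply, Finsupp.single_apply]
  split_ifs
  · simpa using ha
  · simp

variable [IsOrderedAddMonoid Γ]

theorem negPart_conj {a : AddMonoidAlgebra ℤ Γ} (ha : a ∈ negPart Γ) (hc : conj a = a) : a = 0 := by
  ext γ
  by_contra h
  have h1 : γ < 0 := ha γ h
  have h2 : (conj a).coeff (-γ) = a.coeff γ := by
    have : (conj a).coeff = Finsupp.mapDomain (fun x : Γ => -x) a.coeff := by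
      simp [conj]
    rw [this, Finsupp.mapDomain_apply neg_injective]
  rw [hc] at h2
  have h3 := ha (-γ) (by rw [h2]; exact h)
  have := neg_pos.2 h1
  exact lt_asymm h3 this

theorem exists_conj_fixed (a : AddMonoidAlgebra ℤ Γ) :
    ∃ m, conj m = m ∧ a - m ∈ negPart Γ := by
  have hs : ∀ (γ : Γ) (n : ℤ), γ < 0 → AddMonoidAlgebra.single γ n ∈ negPart Γ := by
    intro γ n hγ δ hδ
    by_contra hc
    apply hδ
    rw [AddMonoidAlgebra.coeff_single, Finsupp.single_apply, if_neg]
    rintro rfl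
    exact hc hγ
  induction a using AddMonoidAlgebra.induction_linear with
  | zero => exact ⟨0, map_zero _, by simp⟩
  | add x y hx hy =>
    obtain ⟨m, hm, h⟩ := hx
    obtain ⟨m', hm', h'⟩ := hy
    refine ⟨m + m', by rw [map_add, hm, hm'], ?_⟩
    rw [add_sub_add_comm]
    exact add_mem h h'
  | single γ n =>
    rcases lt_trichotomy γ 0 with h | h | h
    · exact ⟨0, map_zero _, by rw [sub_zero]; exact hs γ n h⟩
    · subst h
      exact ⟨AddMonoidAlgebra.single 0 n, by rw [conj_single, neg_zero], by simp⟩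
    · refine ⟨AddMonoidAlgebra.single γ n + AddMonoidAlgebra.single (-γ) n, ?_, ?_⟩
      · rw [map_add, conj_single, conj_single, neg_neg, add_comm]
      · rw [sub_add_cancel_left]
        exact neg_mem (hs _ _ (neg_lt_zero.2 h))

theorem correct (n : ℕ) (g : Hecke cs φ) (hg : g ∈ low cs φ n) :
    ∃ k ∈ low cs φ n, bar cs φ k = k ∧ g - k ∈ negHecke cs φ := by
  induction n generalizing g with
  | zero =>
    refine ⟨0, zero_mem _, bar_zero cs φ, ?_⟩
    have : g = 0 := by
      apply (stdBasis cs φ).repr.injective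
      ext1 w
      rw [map_zero]; exact hg w (Nat.zero_le _)
    rw [this, sub_zero]; exact zero_mem _
  | succ n ih =>
    refine low_induct cs φ (p := fun g => ∃ k ∈ low cs φ (n + 1),
      bar cs φ k = k ∧ g - k ∈ negHecke cs φ) hg ⟨0, zero_mem _, bar_zero cs φ, by simp⟩ ?_ fun w hw a => ?_
    · rintro x y ⟨k, h1, h2, h3⟩ ⟨k', h1', h2', h3'⟩
      refine ⟨k + k', add_mem h1 h1', by rw [bar_add, h2, h2'], ?_⟩
      rw [add_sub_add_comm]
      exact add_mem h3 h3'
    · obtain ⟨m, hm, hm'⟩ := exists_conj_fixed a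
      obtain ⟨p, hp, hp'⟩ := exists_bar_fixed cs φ w
      have hl : m • (p - T cs φ w) ∈ low cs φ n :=
        Submodule.smul_mem _ _ (low_mono cs φ (by omega) hp')
      obtain ⟨k, h1, h2, h3⟩ := ih _ hl
      refine ⟨m • p - k, ?_, ?_, ?_⟩
      · refine sub_mem (Submodule.smul_mem _ _ ?_) (low_mono cs φ (Nat.le_succ n) h1)
        have : p = T cs φ w + (p - T cs φ w) := by abel
        rw [this]
        exact add_mem (T_mem_low _ _ hw) (low_mono cs φ (by omega) hp')
      · rw [bar_sub, bar_smul, hm, hp, h2]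
      · have h4 := sub_mem (smul_T_mem_negHecke cs φ hm' w) h3
        convert h4 using 1
        rw [sub_smul, smul_sub]
        abel

theorem exists_kl (w : W) : ∃ c : Hecke cs φ, (bar cs φ c = c ∧ c - T cs φ w ∈ negHecke cs φ) ∧
    c - T cs φ w ∈ low cs φ (cs.length w) := by
  obtain ⟨p, hp, hp'⟩ := exists_bar_fixed cs φ w
  obtain ⟨k, h1, h2, h3⟩ := correct cs φ _ _ hp'
  refine ⟨p - k, ⟨by rw [bar_sub, hp, h2], ?_⟩, ?_⟩
  · rwa [sub_right_comm]
  · rw [sub_right_comm]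
    exact sub_mem hp' h1

theorem eq_zero_of_bar {h : Hecke cs φ} (hb : bar cs φ h = h) (hn : h ∈ negHecke cs φ) : h = 0 := by
  by_contra hne
  obtain ⟨w, hw, hmax⟩ := exists_top cs ((stdBasis cs φ).repr h)
    (fun h0 => hne ((stdBasis cs φ).repr.map_eq_zero_iff.1 h0))
  have h1 := top_coeff cs φ (conj (Γ := Γ)).toAddMonoidHom (fun w => Ring.inverse (T cs φ w⁻¹))
    (fun w => by rw [← bar_T]; exact bar_T_sub_mem cs φ w) ((stdBasis cs φ).repr h) w hmax
  have h2 : (stdBasis cs φ).repr (bar cs φ h) w = conj ((stdBasis cs φ).repr h w) := h1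
  rw [hb] at h2
  exact Finsupp.mem_support_iff.1 hw (negPart_conj (hn w) h2.symm)

theorem kl_unique {w : W} {c c' : Hecke cs φ}
    (h : bar cs φ c = c ∧ c - T cs φ w ∈ negHecke cs φ)
    (h' : bar cs φ c' = c' ∧ c' - T cs φ w ∈ negHecke cs φ) : c = c' := by
  rw [← sub_eq_zero]
  apply eq_zero_of_bar cs φ
  · rw [bar_sub, h.1, h'.1]
  · rw [← sub_sub_sub_cancel_right c c' (T cs φ w)]
    exact sub_mem h.2 h'.2

theorem existsUnique_kl (w : W) :
    ∃! c : Hecke cs φ, bar cs φ c = c ∧ c - T cs φ w ∈ negHecke cs φ := by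
  obtain ⟨c, hc, _⟩ := exists_kl cs φ w
  exact ⟨c, hc, fun c' hc' => kl_unique cs φ hc' hc⟩

/-- The Kazhdan-Lusztig element `C_w`: the unique bar-invariant element congruent to `T_w` modulo
`ℋ_{<0}`. -/
def C (w : W) : Hecke cs φ := (existsUnique_kl cs φ w).choose

theorem C_spec (w : W) :
    bar cs φ (C cs φ w) = C cs φ w ∧ C cs φ w - T cs φ w ∈ negHecke cs φ :=
  (existsUnique_kl cs φ w).choose_spec.1

theorem C_sub_T_mem_low (w : W) : C cs φ w - T cs φ w ∈ low cs φ (cs.length w) := by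
  obtain ⟨c, hc, h⟩ := exists_kl cs φ w
  rwa [kl_unique cs φ (C_spec cs φ w) hc]

theorem C_linearIndependent : LinearIndependent (AddMonoidAlgebra ℤ Γ) (C cs φ) := by
  rw [linearIndependent_iff]
  intro l hl
  by_contra hne
  obtain ⟨w, hw, hmax⟩ := exists_top cs l hne
  have h1 := top_coeff cs φ (AddMonoidHom.id _) (C cs φ) (C_sub_T_mem_low cs φ) l w hmax
  rw [Finsupp.linearCombination_apply] at hl
  have h2 : (stdBasis cs φ).repr (l.sum fun y a => a • C cs φ y) w = l w := h1
  rw [hl, map_zero] at h2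
  exact Finsupp.mem_support_iff.1 hw h2.symm

theorem C_span : (⊤ : Submodule (AddMonoidAlgebra ℤ Γ) (Hecke cs φ)) ≤
    Submodule.span _ (Set.range (C cs φ)) := by
  have h : ∀ n, low cs φ n ≤ Submodule.span _ (Set.range (C cs φ)) := by
    intro n
    induction n with
    | zero =>
      intro g hg
      exact low_induct cs φ hg (zero_mem _) (fun x y => add_mem) (fun w hw => by omega)
    | succ n ih =>
      intro g hg
      refine low_induct cs φ hg (zero_mem _) (fun x y => add_mem) (fun w hw a => ?_)
      refine Submodule.smul_mem _ _ ?_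
      have h1 : T cs φ w = C cs φ w - (C cs φ w - T cs φ w) := by abel
      rw [h1]
      exact sub_mem (Submodule.subset_span ⟨w, rfl⟩)
        (ih (low_mono cs φ (by omega) (C_sub_T_mem_low cs φ w)))
  intro g _
  refine induct cs φ g (zero_mem _) (fun x y => add_mem) fun w _ a => Submodule.smul_mem _ _ ?_
  exact h _ (T_mem_low cs φ (Nat.lt_succ_self (cs.length w)))

/-- The Kazhdan-Lusztig basis `(C_w)`. -/
def klBasis : Module.Basis W (AddMonoidAlgebra ℤ Γ) (Hecke cs φ) :=
  Module.Basis.mk (C_linearIndependent cs φ) (C_span cs φ)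

theorem klBasis_apply (w : W) : klBasis cs φ w = C cs φ w := Module.Basis.mk_apply _ _ w

end Hecke

end KL

/-! ## Cells -/

/-- The three kinds of cells: left (`L`), right (`R`) and two-sided (`LR`). -/
inductive Side
  | L
  | R
  | LR

/-- `L` or `LR`: the sides on which one can multiply on the left. -/
class Side.HasLeft (σ : Side) : Prop where
  out : σ = Side.L ∨ σ = Side.LR

/-- `R` or `LR`: the sides on which one can multiply on the right. -/
class Side.HasRight (σ : Side) : Prop where
  out : σ = Side.R ∨ σ = Side.LR

instance : Side.HasLeft Side.L := ⟨Or.inl rfl⟩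
instance : Side.HasLeft Side.LR := ⟨Or.inr rfl⟩
instance : Side.HasRight Side.R := ⟨Or.inl rfl⟩
instance : Side.HasRight Side.LR := ⟨Or.inr rfl⟩

section Cells

variable {B W : Type*} [Group W] {M : CoxeterMatrix B} {Γ : Type*} [AddCommGroup Γ] [LinearOrder Γ]
  [IsOrderedAddMonoid Γ] (cs : CoxeterSystem M W) (φ : SBar cs → Γ) (σ : Side)

/-- The relation `x ⟵ y`: the coefficient of `C_x` in `h C_y` (if `σ = L`), in `C_y h`
(if `σ = R`), in `h C_y` or in `C_y h` (if `σ = LR`) is non-zero for some `h`. -/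
def klStep (x y : W) : Prop :=
  match σ with
  | Side.L => ∃ h : Hecke cs φ, (Hecke.klBasis cs φ).repr (h * Hecke.C cs φ y) x ≠ 0
  | Side.R => ∃ h : Hecke cs φ, (Hecke.klBasis cs φ).repr (Hecke.C cs φ y * h) x ≠ 0
  | Side.LR => ∃ h : Hecke cs φ, (Hecke.klBasis cs φ).repr (h * Hecke.C cs φ y) x ≠ 0 ∨
      (Hecke.klBasis cs φ).repr (Hecke.C cs φ y * h) x ≠ 0

/-- The Kazhdan-Lusztig preorder: the transitive closure of `⟵`. -/
def klLE (x y : W) : Prop := Relation.TransGen (klStep cs φ σ) x y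

/-- The equivalence relation associated with the Kazhdan-Lusztig preorder. -/
def klEquiv (x y : W) : Prop := klLE cs φ σ x y ∧ klLE cs φ σ y x

/-- The cell of `w`. -/
def klCell (w : W) : Set W := {x | klEquiv cs φ σ x w}

variable {σ} in
theorem klStep_of_left [hσ : σ.HasLeft] {x y : W} (h : Hecke cs φ)
    (hx : (Hecke.klBasis cs φ).repr (h * Hecke.C cs φ y) x ≠ 0) : klStep cs φ σ x y := by
  rcases hσ.out with rfl | rfl
  · exact ⟨h, hx⟩
  · exact ⟨h, Or.inl hx⟩

variable {σ} in
theorem klStep_of_right [hσ : σ.HasRight] {x y : W} (h : Hecke cs φ)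
    (hx : (Hecke.klBasis cs φ).repr (Hecke.C cs φ y * h) x ≠ 0) : klStep cs φ σ x y := by
  rcases hσ.out with rfl | rfl
  · exact ⟨h, hx⟩
  · exact ⟨h, Or.inr hx⟩

/-! ### Cell modules -/

/-- The set of `x` with `x ≤ X`. -/
def lowerSet (X : Set W) : Set W := {x | ∃ c ∈ X, klLE cs φ σ x c}

/-- The set of `x` with `x < X` (for a cell `X`: `x ≤ X` and `x ∉ X`). -/
def strictLowerSet (X : Set W) : Set W := {x | ∃ c ∈ X, klLE cs φ σ x c ∧ ¬ klLE cs φ σ c x}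

/-- The `ℤ[Γ]`-span of the `C_x` with `x ∈ D`. -/
def spanC (D : Set W) : Submodule (AddMonoidAlgebra ℤ Γ) (Hecke cs φ) :=
  Submodule.span (AddMonoidAlgebra ℤ Γ) (Hecke.C cs φ '' D)

theorem lowerSet_closed (X : Set W) {x y : W} (h : klStep cs φ σ x y)
    (hy : y ∈ lowerSet cs φ σ X) : x ∈ lowerSet cs φ σ X := by
  obtain ⟨c, hc, hyc⟩ := hy
  exact ⟨c, hc, Relation.TransGen.head h hyc⟩

theorem strictLowerSet_closed (X : Set W) {x y : W} (h : klStep cs φ σ x y)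
    (hy : y ∈ strictLowerSet cs φ σ X) : x ∈ strictLowerSet cs φ σ X := by
  obtain ⟨c, hc, hyc, hcy⟩ := hy
  exact ⟨c, hc, Relation.TransGen.head h hyc, fun hcx => hcy (Relation.TransGen.tail hcx h)⟩

theorem mem_spanC_of_repr {D : Set W} (h : Hecke cs φ)
    (hD : ∀ x, (Hecke.klBasis cs φ).repr h x ≠ 0 → x ∈ D) : h ∈ spanC cs φ D := by
  rw [← (Hecke.klBasis cs φ).linearCombination_repr h, Finsupp.linearCombination_apply]
  refine Submodule.sum_mem _ fun x hx => Submodule.smul_mem _ _ (Submodule.subset_span ?_)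
  exact ⟨x, hD x (Finsupp.mem_support_iff.1 hx), (Hecke.klBasis_apply cs φ x).symm⟩

variable {σ} in
theorem spanC_mul_left [σ.HasLeft] {D : Set W}
    (hD : ∀ x y, klStep cs φ σ x y → y ∈ D → x ∈ D) (h : Hecke cs φ) :
    ∀ m ∈ spanC cs φ D, LinearMap.mulLeft (AddMonoidAlgebra ℤ Γ) h m ∈ spanC cs φ D := by
  intro m hm
  refine Submodule.span_le (p := (spanC cs φ D).comap (LinearMap.mulLeft _ h)).2 ?_ hm
  rintro _ ⟨y, hy, rfl⟩
  exact mem_spanC_of_repr cs φ _ fun x hx => hD x y (klStep_of_left cs φ h hx) hy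

variable {σ} in
theorem spanC_mul_right [σ.HasRight] {D : Set W}
    (hD : ∀ x y, klStep cs φ σ x y → y ∈ D → x ∈ D) (h : Hecke cs φ) :
    ∀ m ∈ spanC cs φ D, LinearMap.mulRight (AddMonoidAlgebra ℤ Γ) h m ∈ spanC cs φ D := by
  intro m hm
  refine Submodule.span_le (p := (spanC cs φ D).comap (LinearMap.mulRight _ h)).2 ?_ hm
  rintro _ ⟨y, hy, rfl⟩
  exact mem_spanC_of_repr cs φ _ fun x hx => hD x y (klStep_of_right cs φ h hx) hy

/-- The cell module `M_X = ℋ_{≤ X} / ℋ_{< X}`, as a `ℤ[Γ]`-module. -/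
abbrev CellModule (X : Set W) : Type _ :=
  spanC cs φ (lowerSet cs φ σ X) ⧸
    (spanC cs φ (strictLowerSet cs φ σ X)).submoduleOf (spanC cs φ (lowerSet cs φ σ X))

variable (X : Set W)

/-- Multiplication by `h` on the left of `M_X`. -/
def cellLeftMul [σ.HasLeft] (h : Hecke cs φ) :
    CellModule cs φ σ X →ₗ[AddMonoidAlgebra ℤ Γ] CellModule cs φ σ X :=
  Submodule.mapQ _ _
    ((LinearMap.mulLeft _ h).restrict (spanC_mul_left cs φ (fun _ _ => lowerSet_closed cs φ σ X) h))
    fun m hm => spanC_mul_left cs φ (fun _ _ => strictLowerSet_closed cs φ σ X) h m.1 hm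

/-- Multiplication by `h` on the right of `M_X`. -/
def cellRightMul [σ.HasRight] (h : Hecke cs φ) :
    CellModule cs φ σ X →ₗ[AddMonoidAlgebra ℤ Γ] CellModule cs φ σ X :=
  Submodule.mapQ _ _
    ((LinearMap.mulRight _ h).restrict
      (spanC_mul_right cs φ (fun _ _ => lowerSet_closed cs φ σ X) h))
    fun m hm => spanC_mul_right cs φ (fun _ _ => strictLowerSet_closed cs φ σ X) h m.1 hm

theorem cellLeftMul_mk [σ.HasLeft] (h : Hecke cs φ) (m : spanC cs φ (lowerSet cs φ σ X)) :
    cellLeftMul cs φ σ X h (Submodule.Quotient.mk m) = Submodule.Quotient.mk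
      ⟨h * m.1, spanC_mul_left cs φ (fun _ _ => lowerSet_closed cs φ σ X) h m.1 m.2⟩ := rfl

theorem cellRightMul_mk [σ.HasRight] (h : Hecke cs φ) (m : spanC cs φ (lowerSet cs φ σ X)) :
    cellRightMul cs φ σ X h (Submodule.Quotient.mk m) = Submodule.Quotient.mk
      ⟨m.1 * h, spanC_mul_right cs φ (fun _ _ => lowerSet_closed cs φ σ X) h m.1 m.2⟩ := rfl

/-- The left `ℋ`-module structure of `M_X` for `σ = L, LR`. -/
def cellLeft [σ.HasLeft] : Hecke cs φ →ₐ[AddMonoidAlgebra ℤ Γ]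
    Module.End (AddMonoidAlgebra ℤ Γ) (CellModule cs φ σ X) :=
  AlgHom.ofLinearMap
    { toFun := cellLeftMul cs φ σ X
      map_add' := fun x y => by
        refine LinearMap.ext fun m => ?_
        obtain ⟨m, rfl⟩ := Submodule.Quotient.mk_surjective _ m
        rw [LinearMap.add_apply, cellLeftMul_mk, cellLeftMul_mk, cellLeftMul_mk,
          ← Submodule.Quotient.mk_add]
        congr 1
        exact Subtype.ext (add_mul x y m.1)
      map_smul' := fun a x => by
        refine LinearMap.ext fun m => ?_
        obtain ⟨m, rfl⟩ := Submodule.Quotient.mk_surjective _ m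
        rw [RingHom.id_apply, LinearMap.smul_apply, cellLeftMul_mk, cellLeftMul_mk,
          ← Submodule.Quotient.mk_smul]
        congr 1
        exact Subtype.ext (smul_mul_assoc a x m.1) }
    (by
      refine LinearMap.ext fun m => ?_
      obtain ⟨m, rfl⟩ := Submodule.Quotient.mk_surjective _ m
      change cellLeftMul cs φ σ X 1 _ = Submodule.Quotient.mk m
      rw [cellLeftMul_mk]
      congr 1
      exact Subtype.ext (one_mul m.1))
    (fun x y => by
      refine LinearMap.ext fun m => ?_
      obtain ⟨m, rfl⟩ := Submodule.Quotient.mk_surjective _ m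
      change cellLeftMul cs φ σ X (x * y) (Submodule.Quotient.mk m) =
        cellLeftMul cs φ σ X x (cellLeftMul cs φ σ X y (Submodule.Quotient.mk m))
      rw [cellLeftMul_mk, cellLeftMul_mk, cellLeftMul_mk]
      congr 1
      exact Subtype.ext (mul_assoc x y m.1))

/-- The right `ℋ`-module structure of `M_X` for `σ = R, LR`. -/
def cellRight [σ.HasRight] : Hecke cs φ →ₐ[AddMonoidAlgebra ℤ Γ]
    (Module.End (AddMonoidAlgebra ℤ Γ) (CellModule cs φ σ X))ᵐᵒᵖ :=
  AlgHom.ofLinearMap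
    { toFun := fun h => MulOpposite.op (cellRightMul cs φ σ X h)
      map_add' := fun x y => by
        rw [← MulOpposite.op_add]
        congr 1
        refine LinearMap.ext fun m => ?_
        obtain ⟨m, rfl⟩ := Submodule.Quotient.mk_surjective _ m
        rw [LinearMap.add_apply, cellRightMul_mk, cellRightMul_mk, cellRightMul_mk,
          ← Submodule.Quotient.mk_add]
        congr 1
        exact Subtype.ext (mul_add m.1 x y)
      map_smul' := fun a x => by
        rw [RingHom.id_apply, ← MulOpposite.op_smul]
        congr 1
        refine LinearMap.ext fun m => ?_
        obtain ⟨m, rfl⟩ := Submodule.Quotient.mk_surjective _ m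
        rw [LinearMap.smul_apply, cellRightMul_mk, cellRightMul_mk, ← Submodule.Quotient.mk_smul]
        congr 1
        exact Subtype.ext (mul_smul_comm a m.1 x) }
    (by
      change MulOpposite.op _ = MulOpposite.op _
      congr 1
      refine LinearMap.ext fun m => ?_
      obtain ⟨m, rfl⟩ := Submodule.Quotient.mk_surjective _ m
      rw [cellRightMul_mk]
      change _ = Submodule.Quotient.mk m
      congr 1
      exact Subtype.ext (mul_one m.1))
    (fun x y => by
      change MulOpposite.op _ = MulOpposite.op _ * MulOpposite.op _
      rw [← MulOpposite.op_mul]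
      congr 1
      refine LinearMap.ext fun m => ?_
      obtain ⟨m, rfl⟩ := Submodule.Quotient.mk_surjective _ m
      change cellRightMul cs φ σ X (x * y) (Submodule.Quotient.mk m) =
        cellRightMul cs φ σ X y (cellRightMul cs φ σ X x (Submodule.Quotient.mk m))
      rw [cellRightMul_mk, cellRightMul_mk, cellRightMul_mk]
      congr 1
      exact Subtype.ext (mul_assoc m.1 x y).symm)

theorem cellLeft_apply [σ.HasLeft] (h : Hecke cs φ) :
    cellLeft cs φ σ X h = cellLeftMul cs φ σ X h := rfl

theorem cellRight_apply [σ.HasRight] (h : Hecke cs φ) :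
    cellRight cs φ σ X h = MulOpposite.op (cellRightMul cs φ σ X h) := rfl

theorem cellLeft_cellRight [σ.HasLeft] [σ.HasRight] (x y : Hecke cs φ) :
    cellLeftMul cs φ σ X x ∘ₗ cellRightMul cs φ σ X y =
      cellRightMul cs φ σ X y ∘ₗ cellLeftMul cs φ σ X x := by
  refine LinearMap.ext fun m => ?_
  obtain ⟨m, rfl⟩ := Submodule.Quotient.mk_surjective _ m
  rw [LinearMap.comp_apply, LinearMap.comp_apply, cellLeftMul_mk, cellRightMul_mk, cellRightMul_mk,
    cellLeftMul_mk]
  congr 1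
  exact Subtype.ext (mul_assoc x m.1 y).symm

end Cells

/-! ### Specialisation of cell modules along the augmentation -/

/-- The augmentation morphism `ℤ[Γ] → ℤ`, `e^γ ↦ 1`. -/
def aug (Γ : Type*) [AddCommGroup Γ] : AddMonoidAlgebra ℤ Γ →+* ℤ :=
  (AddMonoidAlgebra.lift ℤ ℤ Γ (1 : Multiplicative Γ →* ℤ)).toRingHom

theorem aug_expo {Γ : Type*} [AddCommGroup Γ] (γ : Γ) : aug Γ (expo γ) = 1 := by
  simp [aug, expo]

/-- The group `ℤ`, seen as a `ℤ[Γ]`-module through the augmentation. -/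
@[nolint unusedArguments]
def AugInt (Γ : Type*) [AddCommGroup Γ] : Type := ℤ

instance (Γ : Type*) [AddCommGroup Γ] : AddCommGroup (AugInt Γ) := inferInstanceAs (AddCommGroup ℤ)

instance (Γ : Type*) [AddCommGroup Γ] : Module (AddMonoidAlgebra ℤ Γ) (AugInt Γ) :=
  Module.compHom ℤ (aug Γ)

theorem augInt_smul {Γ : Type*} [AddCommGroup Γ] (a : AddMonoidAlgebra ℤ Γ) (n : AugInt Γ) :
    a • n = (show ℤ from aug Γ a * (show ℤ from n)) := rfl

section Specialise

variable {B W : Type*} [Group W] {M : CoxeterMatrix B} {A : Type*} [CommRing A]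

/-- An algebra morphism `ℋ → E` killing the parameters `u` factors through the group algebra of `W`:
`w` acts as `T_w`. -/
def specialise (cs : CoxeterSystem M W) (u : SBar cs → A) {E : Type*} [Ring E] [Algebra A E]
    (f : GHecke cs u →ₐ[A] E) (hf : ∀ ω, u ω • (1 : E) = 0) : W →* E where
  toFun w := f (GHecke.T cs u w)
  map_one' := by rw [GHecke.T_one, map_one]
  map_mul' := by
    have h0 : ∀ ω (e : E), u ω • e = 0 := fun ω e => by
      rw [← one_mul e, ← smul_mul_assoc, hf, zero_mul]
    have hs : ∀ i w, f (GHecke.T cs u (cs.simple i * w)) =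
        f (GHecke.T cs u (cs.simple i)) * f (GHecke.T cs u w) := by
      intro i w
      rw [← map_mul, GHecke.T_simple_mul_T, map_add, map_smul]
      split_ifs
      · rw [h0, add_zero]
      · rw [zero_smul, add_zero]
    intro x y
    induction x using cs.simple_induction_left with
    | one => rw [one_mul, GHecke.T_one, map_one, one_mul]
    | mul_simple_left w i ih => rw [mul_assoc, hs, ih, hs, mul_assoc]

end Specialise

open scoped TensorProduct in
/-- The specialised cell module `ℤ M_X = ℤ ⊗_{ℤ[Γ]} M_X`. -/
def IntCellModule {B W : Type*} [Group W] {M : CoxeterMatrix B} {Γ : Type*} [AddCommGroup Γ]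
    [LinearOrder Γ] [IsOrderedAddMonoid Γ] (cs : CoxeterSystem M W) (φ : SBar cs → Γ) (σ : Side)
    (X : Set W) : Type _ :=
  AugInt Γ ⊗[AddMonoidAlgebra ℤ Γ] CellModule cs φ σ X

section IntCell

variable {B W : Type*} [Group W] {M : CoxeterMatrix B} {Γ : Type*} [AddCommGroup Γ] [LinearOrder Γ]
  [IsOrderedAddMonoid Γ] (cs : CoxeterSystem M W) (φ : SBar cs → Γ) (σ : Side) (X : Set W)

open scoped TensorProduct

instance : AddCommGroup (IntCellModule cs φ σ X) :=
  inferInstanceAs (AddCommGroup (AugInt Γ ⊗[AddMonoidAlgebra ℤ Γ] CellModule cs φ σ X))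

instance : Module (AddMonoidAlgebra ℤ Γ) (IntCellModule cs φ σ X) :=
  inferInstanceAs (Module (AddMonoidAlgebra ℤ Γ)
    (AugInt Γ ⊗[AddMonoidAlgebra ℤ Γ] CellModule cs φ σ X))

/-- `f ↦ 1 ⊗ f`. -/
def tensorMap : Module.End (AddMonoidAlgebra ℤ Γ) (CellModule cs φ σ X) →ₐ[AddMonoidAlgebra ℤ Γ]
    Module.End (AddMonoidAlgebra ℤ Γ) (IntCellModule cs φ σ X) :=
  Module.End.lTensorAlgHom (AddMonoidAlgebra ℤ Γ) (CellModule cs φ σ X) (AugInt Γ)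

theorem param_smul (ω : SBar cs) (x : IntCellModule cs φ σ X) :
    (expo (φ ω) - expo (-φ ω)) • x = 0 := by
  have h : ∀ x : AugInt Γ ⊗[AddMonoidAlgebra ℤ Γ] CellModule cs φ σ X,
      (expo (φ ω) - expo (-φ ω)) • x = 0 := by
    intro x
    induction x using TensorProduct.induction_on with
    | zero => exact smul_zero _
    | tmul n m =>
      have h0 : (expo (φ ω) - expo (-φ ω)) • n = (0 : AugInt Γ) := by
        rw [augInt_smul, map_sub, aug_expo, aug_expo, sub_self, zero_mul]
        rfl
      rw [TensorProduct.smul_tmul', h0, TensorProduct.zero_tmul]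
    | add x y hx hy => rw [smul_add, hx, hy, add_zero]
  exact h x

/-- `w` acts on `ℤ M_X` on the left as `1 ⊗ T_w`. -/
def intCellLeft [σ.HasLeft] :
    W →* Module.End (AddMonoidAlgebra ℤ Γ) (IntCellModule cs φ σ X) :=
  specialise cs _ ((tensorMap cs φ σ X).comp (cellLeft cs φ σ X))
    fun ω => LinearMap.ext fun x => param_smul cs φ σ X ω x

/-- `w` acts on `ℤ M_X` on the right as `1 ⊗ T_w`. -/
def intCellRight [σ.HasRight] :
    W →* (Module.End (AddMonoidAlgebra ℤ Γ) (IntCellModule cs φ σ X))ᵐᵒᵖ :=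
  specialise cs _ ((AlgHom.op (tensorMap cs φ σ X)).comp (cellRight cs φ σ X))
    fun ω => congrArg MulOpposite.op (LinearMap.ext fun x => param_smul cs φ σ X ω x)

/-- The left `ℤ W`-module structure of `ℤ M_X` for `σ = L, LR`. -/
instance [σ.HasLeft] : Module (MonoidAlgebra ℤ W) (IntCellModule cs φ σ X) :=
  Module.compHom _ (MonoidAlgebra.lift ℤ _ W (intCellLeft cs φ σ X)).toRingHom

/-- The right `ℤ W`-module structure of `ℤ M_X` for `σ = R, LR`. -/
instance [σ.HasRight] : Module (MonoidAlgebra ℤ W)ᵐᵒᵖ (IntCellModule cs φ σ X) :=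
  Module.compHom _ ((RingEquiv.opOp _).symm.toRingHom.comp
    (RingHom.op (MonoidAlgebra.lift ℤ _ W (intCellRight cs φ σ X)).toRingHom))

theorem single_smul [σ.HasLeft] (w : W) (n : AugInt Γ) (m : CellModule cs φ σ X) :
    MonoidAlgebra.single w (1 : ℤ) • (show IntCellModule cs φ σ X from n ⊗ₜ m) =
      (show IntCellModule cs φ σ X from n ⊗ₜ cellLeftMul cs φ σ X (Hecke.T cs φ w) m) := by
  change (MonoidAlgebra.lift ℤ _ W (intCellLeft cs φ σ X)) (MonoidAlgebra.single w (1 : ℤ)) _ = _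
  rw [MonoidAlgebra.lift_single, one_smul]
  rfl

theorem single_op_smul [σ.HasRight] (w : W) (n : AugInt Γ) (m : CellModule cs φ σ X) :
    MulOpposite.op (MonoidAlgebra.single w (1 : ℤ)) •
        (show IntCellModule cs φ σ X from n ⊗ₜ m) =
      (show IntCellModule cs φ σ X from n ⊗ₜ cellRightMul cs φ σ X (Hecke.T cs φ w) m) := by
  change ((MonoidAlgebra.lift ℤ _ W (intCellRight cs φ σ X))
    (MonoidAlgebra.single w (1 : ℤ))).unop _ = _
  rw [MonoidAlgebra.lift_single, one_smul]
  rfl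

/-- For `σ = LR`, the two structures make `ℤ M_X` a bimodule. -/
instance [σ.HasLeft] [σ.HasRight] :
    SMulCommClass (MonoidAlgebra ℤ W) (MonoidAlgebra ℤ W)ᵐᵒᵖ (IntCellModule cs φ σ X) where
  smul_comm a b x := by
    have hw : ∀ w w' : W, Commute (intCellLeft cs φ σ X w) (intCellRight cs φ σ X w').unop := by
      intro w w'
      change tensorMap cs φ σ X (cellLeftMul cs φ σ X (Hecke.T cs φ w)) *
          tensorMap cs φ σ X (cellRightMul cs φ σ X (Hecke.T cs φ w')) =
        tensorMap cs φ σ X (cellRightMul cs φ σ X (Hecke.T cs φ w')) *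
          tensorMap cs φ σ X (cellLeftMul cs φ σ X (Hecke.T cs φ w))
      rw [← map_mul, ← map_mul]
      exact congrArg _ (cellLeft_cellRight cs φ σ X _ _)
    have h : ∀ a b : MonoidAlgebra ℤ W,
        Commute (MonoidAlgebra.lift ℤ _ W (intCellLeft cs φ σ X) a)
          (MonoidAlgebra.lift ℤ _ W (intCellRight cs φ σ X) b).unop := by
      intro a b
      induction a using MonoidAlgebra.induction_linear with
      | zero => rw [map_zero]; exact Commute.zero_left _
      | add a a' ha ha' => rw [map_add]; exact ha.add_left ha'
      | single w n =>
        induction b using MonoidAlgebra.induction_linear with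
        | zero => rw [map_zero]; exact Commute.zero_right _
        | add b b' hb hb' => rw [map_add]; exact hb.add_right hb'
        | single w' n' =>
          rw [MonoidAlgebra.lift_single, MonoidAlgebra.lift_single, MulOpposite.unop_smul]
          exact ((hw w w').smul_left n).smul_right n'
    exact LinearMap.congr_fun (h a b.unop) x

end IntCell

/-! ## Positive subsets -/

/-- A positive subset `X` of an abelian group: `Λ = X ∪ (-X)`, `X + X ⊆ X`, and `X ∩ (-X)` is
a subgroup. -/
@[ext]
structure PositiveSubset (Λ : Type*) [AddCommGroup Λ] where
  carrier : Set Λ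
  total : ∀ x, x ∈ carrier ∨ -x ∈ carrier
  add_mem : ∀ x ∈ carrier, ∀ y ∈ carrier, x + y ∈ carrier
  inter_neg : ∃ H : AddSubgroup Λ, ∀ x, x ∈ H ↔ x ∈ carrier ∧ -x ∈ carrier

namespace PositiveSubset

variable {Λ : Type*} [AddCommGroup Λ]

/-- The positive subset `Pos(f) = {x | f x ≥ 0}` of a morphism to a totally ordered group. -/
def pos {Γ : Type*} [AddCommGroup Γ] [LinearOrder Γ] [IsOrderedAddMonoid Γ] (f : Λ →+ Γ) :
    PositiveSubset Λ where
  carrier := {x | 0 ≤ f x}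
  total x := by
    simp only [Set.mem_ofPred_eq, map_neg, Left.nonneg_neg_iff]
    exact le_total _ _
  add_mem x hx y hy := by
    simp only [Set.mem_ofPred_eq, map_add] at *
    exact add_nonneg hx hy
  inter_neg := ⟨f.ker, fun x => by
    simp only [AddMonoidHom.mem_ker, Set.mem_ofPred_eq, map_neg, Left.nonneg_neg_iff]
    exact ⟨fun h => ⟨h.ge, h.le⟩, fun h => le_antisymm h.2 h.1⟩⟩

variable (X : PositiveSubset Λ)

theorem zero_mem : (0 : Λ) ∈ X.carrier := by
  have := X.total 0
  rwa [neg_zero, or_self] at this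

/-- The subgroup `X ∩ (-X)`. -/
def core : AddSubgroup Λ where
  carrier := {x | x ∈ X.carrier ∧ -x ∈ X.carrier}
  zero_mem' := ⟨X.zero_mem, by rw [neg_zero]; exact X.zero_mem⟩
  add_mem' := fun {x y} hx hy => ⟨X.add_mem _ hx.1 _ hy.1, by
    rw [neg_add]; exact X.add_mem _ hx.2 _ hy.2⟩
  neg_mem' := fun {x} hx => ⟨hx.2, by rw [neg_neg]; exact hx.1⟩

/-- The group `Λ / (X ∩ (-X))`. -/
def Quo : Type _ := Λ ⧸ X.core

instance : AddCommGroup X.Quo := inferInstanceAs (AddCommGroup (Λ ⧸ X.core))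

/-- The canonical morphism `Λ → Λ / (X ∩ (-X))`. -/
def can : Λ →+ X.Quo := QuotientAddGroup.mk' X.core

theorem can_eq_zero {x : Λ} : X.can x = 0 ↔ x ∈ X.carrier ∧ -x ∈ X.carrier :=
  QuotientAddGroup.eq_zero_iff x

theorem can_surjective : Function.Surjective X.can := QuotientAddGroup.mk'_surjective X.core

open scoped Classical in
/-- The order on `Λ / (X ∩ (-X))`: `a ≤ b` if some representative of `b - a` belongs to `X`. -/
instance : LinearOrder X.Quo where
  le a b := ∃ x ∈ X.carrier, X.can x = b - a
  le_refl a := ⟨0, X.zero_mem, by rw [map_zero, sub_self]⟩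
  le_trans a b c := by
    rintro ⟨x, hx, h⟩ ⟨y, hy, h'⟩
    exact ⟨x + y, X.add_mem _ hx _ hy, by rw [map_add, h, h']; abel⟩
  le_antisymm a b := by
    rintro ⟨x, hx, h⟩ ⟨y, hy, h'⟩
    have h1 : X.can (x + y) = 0 := by rw [map_add, h, h']; abel
    have h2 := X.add_mem _ (X.can_eq_zero.1 h1).2 _ hy
    have h3 : X.can x = 0 := X.can_eq_zero.2 ⟨hx, by
      rwa [show -(x + y) + y = -x by abel] at h2⟩
    rw [h3, eq_comm, sub_eq_zero] at h
    exact h.symm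
  le_total a b := by
    obtain ⟨x, hx⟩ := X.can_surjective (b - a)
    rcases X.total x with h | h
    · exact Or.inl ⟨x, h, hx⟩
    · exact Or.inr ⟨-x, h, by rw [map_neg, hx, neg_sub]⟩
  toDecidableLE := Classical.decRel _

theorem le_def (a b : X.Quo) : a ≤ b ↔ ∃ x ∈ X.carrier, X.can x = b - a := Iff.rfl

instance : IsOrderedAddMonoid X.Quo where
  add_le_add_left a b h c := by
    rw [le_def] at h ⊢
    obtain ⟨x, hx, h⟩ := h
    exact ⟨x, hx, by rw [h]; abel⟩

end PositiveSubset

section Weights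

variable {S Γ : Type*} [AddCommGroup Γ]

/-- The extension of `φ : S → Γ` to a morphism of groups `ℤ[S] → Γ`. -/
def extend (φ : S → Γ) : (S →₀ ℤ) →+ Γ :=
  Finsupp.liftAddHom fun s => zmultiplesHom Γ (φ s)

theorem extend_single (φ : S → Γ) (s : S) : extend φ (Finsupp.single s 1) = φ s := by
  simp [extend]

/-- The canonical map `φ_X : S → ℤ[S] / (X ∩ (-X))`. -/
def canWeight (X : PositiveSubset (S →₀ ℤ)) (s : S) : X.Quo := X.can (Finsupp.single s 1)

end Weights

end KLCells

end

/-! Let `X = Pos(φ)`. The subgroup `X ∩ (-X)` is the kernel of the extended morphism `ℤ[S̄] → Γ`,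
and the order on `Γ_X` is the one pulled back from `Γ`. So `Γ_X` embeds in `Γ` by a strictly
increasing morphism `ι` with `ι ∘ φ_X = φ` (`quoHom_canWeight`, `quoHom_strictMono`). It remains to
compare two weights related by such an `ι`.

The ring morphism `e^γ ↦ e^(ι γ)` matches the Hecke parameters, so it extends to a ring morphism of
Hecke algebras with `T_w ↦ T_w`. This morphism commutes with the bar involutions and, because `ι` is
strictly increasing, carries `ℋ_{<0}` into `ℋ_{<0}`. The image of `C_w` therefore satisfies the two
conditions characterising `C_w` in the target, and uniqueness gives `C_w ↦ C_w` (`Hecke.map_C`).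
Hence coordinates in the Kazhdan–Lusztig bases correspond under an injective ring morphism, and a
coefficient vanishes on one side exactly when it vanishes on the other. The elementary relation can
be tested with `h = T_w` only, so it is the same for both weights (`klStep_map`); preorders,
equivalences and cells follow.

For the modules, `ι` is compatible with the augmentations, so the morphism of Hecke algebras induces
an additive map between the specialised modules. It sends the class of `C_x` to the class of `C_x`,
and commutes with `W` because `T_w ↦ T_w`. Both modules are generated as abelian groups by these
classes, with no relations except that the class of `C_x` is zero for `x < X`; this yields the
inverse (`intCell_hom_ext`, `intCellLift`, `intCellEquiv`).

Two weights with the same positive subset `X` are each compared with `φ_X`, and hence with each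
other. -/

noncomputable section

namespace KLCells

/-! ## Change of scalars for Hecke algebras -/

namespace GHecke

variable {B W : Type*} [Group W] {M : CoxeterMatrix B} (cs : CoxeterSystem M W)
  {A A' : Type*} [CommRing A] [CommRing A'] (f : A →+* A') {u : SBar cs → A} {u' : SBar cs → A'}

/-- Change of scalars on the coefficients in the standard basis, as an additive map. -/
def mapAdd (u : SBar cs → A) (u' : SBar cs → A') : GHecke cs u →+ GHecke cs u' :=
  ((basis cs u').repr.symm.toAddEquiv.toAddMonoidHom.comp
    (Finsupp.mapRange.addMonoidHom f.toAddMonoidHom)).comp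
    (basis cs u).repr.toAddEquiv.toAddMonoidHom

theorem basis_repr_mapAdd (x : GHecke cs u) (w : W) :
    (basis cs u').repr (mapAdd cs f u u' x) w = f ((basis cs u).repr x w) := by
  simp [mapAdd]

theorem mapAdd_T (w : W) : mapAdd cs f u u' (T cs u w) = T cs u' w := by
  classical
  apply (basis cs u').repr.injective
  ext y
  rw [basis_repr_mapAdd, T, T, Module.Basis.repr_self, Module.Basis.repr_self,
    Finsupp.single_apply, Finsupp.single_apply]
  split_ifs <;> simp

theorem mapAdd_smul (a : A) (x : GHecke cs u) :
    mapAdd cs f u u' (a • x) = f a • mapAdd cs f u u' x := by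
  apply (basis cs u').repr.injective
  ext y
  rw [basis_repr_mapAdd, map_smul, map_smul, Finsupp.smul_apply, Finsupp.smul_apply,
    basis_repr_mapAdd, smul_eq_mul, smul_eq_mul, map_mul]

/-- Additive properties can be checked on multiples of the `T_w`. -/
theorem induction_T {p : GHecke cs u → Prop} (h : GHecke cs u) (h0 : p 0)
    (hadd : ∀ x y, p x → p y → p (x + y)) (hT : ∀ (a : A) (w : W), p (a • T cs u w)) : p h := by
  rw [← (basis cs u).linearCombination_repr h, Finsupp.linearCombination_apply]
  exact Finset.sum_induction _ p hadd h0 fun w _ => hT _ w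

theorem T_simple_mul_T_of_gt {i : B} {w : W}
    (h : cs.length (cs.simple i * w) < cs.length w) :
    T cs u (cs.simple i) * T cs u (cs.simple i * w) = T cs u w := by
  rw [T_simple_mul_T_of_lt, cs.simple_mul_simple_cancel_left]
  rwa [cs.simple_mul_simple_cancel_left]

/-- In `T_s T_w = T_{sw} + (0 or u(s)) T_w` the choice between `0` and `u(s)` depends only on
lengths in `W`, so it is the same in both algebras, and `f` matches the parameters. -/
theorem mapAdd_T_simple_mul (hu : ∀ ω, f (u ω) = u' ω) (i : B) (x : GHecke cs u) :
    mapAdd cs f u u' (T cs u (cs.simple i) * x) =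
      T cs u' (cs.simple i) * mapAdd cs f u u' x := by
  induction x using induction_T with
  | h0 => simp
  | hadd x y hx hy => rw [mul_add, map_add, map_add, mul_add, hx, hy]
  | hT a w =>
    rw [mul_smul_comm, mapAdd_smul, mapAdd_smul, mul_smul_comm, mapAdd_T, T_simple_mul_T,
      T_simple_mul_T, map_add, mapAdd_smul, mapAdd_T, mapAdd_T]
    split_ifs
    · rw [hu]
    · rw [map_zero]

/-- Induction on `ℓ(w)`: a left descent `s` of `w` gives `T_w = T_s T_{sw}` in both algebras, which
reduces to the case of a simple reflection. -/
theorem mapAdd_T_mul (hu : ∀ ω, f (u ω) = u' ω) (w : W) (x : GHecke cs u) :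
    mapAdd cs f u u' (T cs u w * x) = T cs u' w * mapAdd cs f u u' x := by
  generalize hn : cs.length w = n
  induction n generalizing w x with
  | zero =>
    rw [cs.length_eq_zero_iff] at hn
    rw [hn, T_one, T_one, one_mul, one_mul]
  | succ n ih =>
    obtain ⟨i, hi⟩ := cs.exists_leftDescent_of_ne_one (w := w)
      (by rw [Ne, ← cs.length_eq_zero_iff]; omega)
    have hi' := (cs.isLeftDescent_iff).1 hi
    rw [← T_simple_mul_T_of_gt cs (u := u) hi, ← T_simple_mul_T_of_gt cs (u := u') hi, mul_assoc,
      mapAdd_T_simple_mul cs f hu, ih _ _ (by omega), mul_assoc]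

/-- Change of scalars along a ring morphism compatible with the parameters. -/
def map (hu : ∀ ω, f (u ω) = u' ω) : GHecke cs u →+* GHecke cs u' where
  __ := mapAdd cs f u u'
  map_one' := mapAdd_T cs f 1
  map_mul' x y := by
    change mapAdd cs f u u' (x * y) = mapAdd cs f u u' x * mapAdd cs f u u' y
    induction x using induction_T with
    | h0 => simp
    | hadd x x' hx hx' => rw [add_mul, map_add, map_add, add_mul, hx, hx']
    | hT a w =>
      rw [smul_mul_assoc, mapAdd_smul, mapAdd_smul, smul_mul_assoc, mapAdd_T,
        mapAdd_T_mul cs f hu]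

end GHecke

/-! ### Base change along a group morphism: group rings and Kazhdan–Lusztig bases -/

section BaseChange

variable {Γ Γ' : Type*} [AddCommGroup Γ] [AddCommGroup Γ'] (ι : Γ →+ Γ')

/-- The ring morphism `ℤ[Γ] → ℤ[Γ']` with `e^γ ↦ e^(ι γ)`. -/
abbrev expMap : AddMonoidAlgebra ℤ Γ →+* AddMonoidAlgebra ℤ Γ' :=
  AddMonoidAlgebra.mapDomainRingHom ℤ ι

theorem expMap_single (γ : Γ) (n : ℤ) :
    expMap ι (AddMonoidAlgebra.single γ n) = AddMonoidAlgebra.single (ι γ) n := by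
  simp [expMap]

theorem expMap_expo (γ : Γ) : expMap ι (expo γ) = expo (ι γ) := expMap_single ι γ 1

theorem coeff_expMap (a : AddMonoidAlgebra ℤ Γ) :
    (expMap ι a).coeff = Finsupp.mapDomain ι a.coeff := by
  simp [expMap]

theorem expMap_injective (hι : Function.Injective ι) : Function.Injective (expMap ι) :=
  AddMonoidAlgebra.mapDomain_injective hι

theorem expMap_conj (a : AddMonoidAlgebra ℤ Γ) : expMap ι (conj a) = conj (expMap ι a) := by
  induction a using AddMonoidAlgebra.induction_linear with
  | zero => simp only [map_zero]
  | add x y hx hy => simp only [map_add, hx, hy]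
  | single γ n => rw [conj_single, expMap_single, expMap_single, conj_single, map_neg]

/-- Both augmentations send every exponential to `1`. This is what makes the tensor products with
`ℤ` comparable. -/
theorem aug_expMap (a : AddMonoidAlgebra ℤ Γ) : aug Γ' (expMap ι a) = aug Γ a := by
  induction a using AddMonoidAlgebra.induction_linear with
  | zero => simp only [map_zero]
  | add x y hx hy => simp only [map_add, hx, hy]
  | single γ n => rw [expMap_single]; simp [aug]

/-- The support of the image lies in the image of the support, and `ι` preserves strict negativity.
This is where the orders on the two groups enter the comparison of bases; later steps also use that
`ι` is injective. -/
theorem expMap_mem_negPart [LinearOrder Γ] [LinearOrder Γ'] (hι : StrictMono ι)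
    {a : AddMonoidAlgebra ℤ Γ} (ha : a ∈ Hecke.negPart Γ) :
    expMap ι a ∈ Hecke.negPart Γ' := by
  classical
  intro γ hγ
  rw [coeff_expMap] at hγ
  obtain ⟨δ, hδ, rfl⟩ := Finset.mem_image.1
    (Finsupp.mapDomain_support (Finsupp.mem_support_iff.2 hγ))
  rw [← map_zero ι]
  exact hι (ha δ (Finsupp.mem_support_iff.1 hδ))

namespace Hecke

variable {B W : Type*} [Group W] {M : CoxeterMatrix B} (cs : CoxeterSystem M W)
  {φ : SBar cs → Γ} {φ' : SBar cs → Γ'} (h : ∀ ω, ι (φ ω) = φ' ω)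

/-- The morphism of Hecke algebras with `e^γ ↦ e^(ι γ)` and `T_w ↦ T_w`. -/
def map : Hecke cs φ →+* Hecke cs φ' :=
  GHecke.map cs (expMap ι) fun ω => by
    rw [map_sub, expMap_expo, expMap_expo, map_neg, h]

theorem map_T (w : W) : map ι cs h (T cs φ w) = T cs φ' w := GHecke.mapAdd_T cs _ (u := fun ω => expo (φ ω) - expo (-φ ω)) w

theorem map_smul' (a : AddMonoidAlgebra ℤ Γ) (x : Hecke cs φ) :
    map ι cs h (a • x) = expMap ι a • map ι cs h x := GHecke.mapAdd_smul cs _ a x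

theorem stdBasis_repr_map (x : Hecke cs φ) (w : W) :
    (stdBasis cs φ').repr (map ι cs h x) w = expMap ι ((stdBasis cs φ).repr x w) :=
  GHecke.basis_repr_mapAdd cs _ x w

/-- Both composites are semilinear in the same way, so it suffices to treat `T_w`, where the point
is that a ring morphism preserves inverses of units. -/
theorem map_bar (x : Hecke cs φ) : map ι cs h (bar cs φ x) = bar cs φ' (map ι cs h x) := by
  induction x using GHecke.induction_T with
  | h0 => rw [bar_zero, map_zero, bar_zero]
  | hadd x y hx hy => rw [bar_add, map_add, map_add, bar_add, hx, hy]
  | hT a w =>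
    rw [bar_smul, map_smul', map_smul', bar_smul, expMap_conj, map_T, bar_T, bar_T,
      ← map_T ι cs h]
    -- `Ring.inverse` takes the value `0` off the units, so it commutes with a ring morphism only
    -- once its argument is exhibited as a unit.
    obtain ⟨v, hv⟩ := isUnit_T cs φ w⁻¹
    have hv' : map ι cs h (v : Hecke cs φ) = Units.map (map ι cs h : _ →* Hecke cs φ') v := rfl
    rw [← hv, Ring.inverse_unit, hv', Ring.inverse_unit]
    rfl

variable [LinearOrder Γ] [LinearOrder Γ'] [IsOrderedAddMonoid Γ] [IsOrderedAddMonoid Γ']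
  (hι : StrictMono ι)
include hι

/-- The uniqueness of the Kazhdan–Lusztig element does all the work: the image is bar-invariant by
`map_bar` and congruent to `T_w` modulo `ℋ_{<0}` by `expMap_mem_negPart`. -/
theorem map_C (w : W) : map ι cs h (C cs φ w) = C cs φ' w := by
  refine kl_unique cs φ' ⟨?_, ?_⟩ (C_spec cs φ' w)
  · rw [← map_bar, (C_spec cs φ w).1]
  · intro y
    rw [← map_T ι cs h, ← map_sub, stdBasis_repr_map]
    exact expMap_mem_negPart ι hι ((C_spec cs φ w).2 y)

/-- Expand `x` in the basis `(C_y)` and apply the semilinear map, which fixes the names of the basis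
vectors. Applied to products such as `T_v C_y`, this compares structure constants. -/
theorem klBasis_repr_map (x : Hecke cs φ) (w : W) :
    (klBasis cs φ').repr (map ι cs h x) w = expMap ι ((klBasis cs φ).repr x w) := by
  classical
  conv_lhs => rw [← (klBasis cs φ).linearCombination_repr x]
  rw [Finsupp.linearCombination_apply, Finsupp.sum, map_sum]
  have h1 : ∀ y, map ι cs h ((klBasis cs φ).repr x y • klBasis cs φ y) =
      expMap ι ((klBasis cs φ).repr x y) • klBasis cs φ' y := fun y => by
    rw [map_smul', klBasis_apply, klBasis_apply, map_C ι cs h hι]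
  simp only [h1, map_sum, _root_.map_smul, Module.Basis.repr_self, Finsupp.finsetSum_apply,
    Finsupp.smul_apply, Finsupp.single_apply, smul_eq_mul, mul_ite, mul_one, mul_zero,
    Finset.sum_ite_eq']
  split_ifs with hw
  · rfl
  · rw [Finsupp.notMem_support_iff.1 hw, map_zero]

end Hecke

/-! ### Preorders and cells under base change -/

section Cells

variable {B W : Type*} [Group W] {M : CoxeterMatrix B} (cs : CoxeterSystem M W)
variable [LinearOrder Γ] [IsOrderedAddMonoid Γ] (φ : SBar cs → Γ)

/-- The multipliers `h` range over two different algebras, and `Hecke.map` need not be surjective.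
The `h` for which the coefficient vanishes form a submodule, so it is enough to test the `T_w`,
which are indexed by `W` on both sides. -/
theorem exists_mul_C_iff (x y : W) :
    (∃ k : Hecke cs φ, (Hecke.klBasis cs φ).repr (k * Hecke.C cs φ y) x ≠ 0) ↔
      ∃ w, (Hecke.klBasis cs φ).repr (Hecke.T cs φ w * Hecke.C cs φ y) x ≠ 0 := by
  refine ⟨fun ⟨k, hk⟩ => ?_, fun ⟨w, hw⟩ => ⟨_, hw⟩⟩
  by_contra! hc
  refine hk ?_
  clear hk
  induction k using GHecke.induction_T with
  | h0 => rw [zero_mul, map_zero, Finsupp.zero_apply]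
  | hadd k l hk hl =>
    rw [add_mul, map_add, Finsupp.add_apply, hk, hl, add_zero]
  | hT a w => rw [smul_mul_assoc, map_smul, Finsupp.smul_apply, hc, smul_zero]

theorem exists_C_mul_iff (x y : W) :
    (∃ k : Hecke cs φ, (Hecke.klBasis cs φ).repr (Hecke.C cs φ y * k) x ≠ 0) ↔
      ∃ w, (Hecke.klBasis cs φ).repr (Hecke.C cs φ y * Hecke.T cs φ w) x ≠ 0 := by
  refine ⟨fun ⟨k, hk⟩ => ?_, fun ⟨w, hw⟩ => ⟨_, hw⟩⟩
  by_contra! hc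
  refine hk ?_
  clear hk
  induction k using GHecke.induction_T with
  | h0 => rw [mul_zero, map_zero, Finsupp.zero_apply]
  | hadd k l hk hl =>
    rw [mul_add, map_add, Finsupp.add_apply, hk, hl, add_zero]
  | hT a w => rw [mul_smul_comm, map_smul, Finsupp.smul_apply, hc, smul_zero]

variable {φ} [LinearOrder Γ'] [IsOrderedAddMonoid Γ'] {φ' : SBar cs → Γ'}
  (h : ∀ ω, ι (φ ω) = φ' ω) (hι : StrictMono ι)
include h hι

theorem klStep_map (σ : Side) (x y : W) : klStep cs φ σ x y ↔ klStep cs φ' σ x y := by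
  -- Injectivity of `expMap ι` gives the converse direction: a non-zero coefficient stays non-zero.
  have h0 : ∀ k : Hecke cs φ, (Hecke.klBasis cs φ).repr k x ≠ 0 ↔
      (Hecke.klBasis cs φ').repr (Hecke.map ι cs h k) x ≠ 0 := fun k => by
    rw [Hecke.klBasis_repr_map ι cs h hι, Ne, Ne,
      map_eq_zero_iff _ (expMap_injective ι hι.injective)]
  have hl : (∃ k : Hecke cs φ, (Hecke.klBasis cs φ).repr (k * Hecke.C cs φ y) x ≠ 0) ↔
      ∃ k : Hecke cs φ', (Hecke.klBasis cs φ').repr (k * Hecke.C cs φ' y) x ≠ 0 := by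
    rw [exists_mul_C_iff, exists_mul_C_iff]
    simp only [h0, map_mul, Hecke.map_T, Hecke.map_C ι cs h hι]
  have hr : (∃ k : Hecke cs φ, (Hecke.klBasis cs φ).repr (Hecke.C cs φ y * k) x ≠ 0) ↔
      ∃ k : Hecke cs φ', (Hecke.klBasis cs φ').repr (Hecke.C cs φ' y * k) x ≠ 0 := by
    rw [exists_C_mul_iff, exists_C_mul_iff]
    simp only [h0, map_mul, Hecke.map_T, Hecke.map_C ι cs h hι]
  cases σ with
  | L => exact hl
  | R => exact hr
  | LR =>
    simp only [klStep, exists_or]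
    exact or_congr hl hr

theorem klLE_map (σ : Side) (x y : W) : klLE cs φ σ x y ↔ klLE cs φ' σ x y := by
  have : klStep cs φ σ = klStep cs φ' σ :=
    funext fun x => funext fun y => propext (klStep_map ι cs h hι σ x y)
  rw [klLE, klLE, this]

theorem klEquiv_map (σ : Side) (x y : W) : klEquiv cs φ σ x y ↔ klEquiv cs φ' σ x y :=
  and_congr (klLE_map ι cs h hι σ x y) (klLE_map ι cs h hι σ y x)

theorem klCell_map (σ : Side) (w : W) : klCell cs φ σ w = klCell cs φ' σ w :=
  Set.ext fun x => klEquiv_map ι cs h hι σ x w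

theorem lowerSet_map (σ : Side) (X : Set W) : lowerSet cs φ σ X = lowerSet cs φ' σ X := by
  simp only [lowerSet, klLE_map ι cs h hι]

theorem strictLowerSet_map (σ : Side) (X : Set W) :
    strictLowerSet cs φ σ X = strictLowerSet cs φ' σ X := by
  simp only [strictLowerSet, klLE_map ι cs h hι]

end Cells

end BaseChange

/-! ## Change of weights for specialised cell modules -/

section AugInt

/-- The identification of `AugInt Γ` with `ℤ`. -/
def augIntEquiv (Γ : Type*) [AddCommGroup Γ] : AugInt Γ ≃+ ℤ := AddEquiv.refl ℤ

theorem augIntEquiv_smul {Γ : Type*} [AddCommGroup Γ] (a : AddMonoidAlgebra ℤ Γ) (n : AugInt Γ) :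
    augIntEquiv Γ (a • n) = aug Γ a * augIntEquiv Γ n := rfl

end AugInt

/-! ### Generators of `ℤ M_X` and maps out of it -/

section IntCellGen

variable {B W : Type*} [Group W] {M : CoxeterMatrix B} {Γ : Type*} [AddCommGroup Γ] [LinearOrder Γ]
  [IsOrderedAddMonoid Γ] (cs : CoxeterSystem M W) (φ : SBar cs → Γ) (σ : Side) (X : Set W)

open scoped TensorProduct

/-- The pure tensor `n ⊗ m` in `ℤ M_X`. -/
def intCellTmul (n : ℤ) (m : CellModule cs φ σ X) : IntCellModule cs φ σ X :=
  (augIntEquiv Γ).symm n ⊗ₜ m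

/-- The image of `C_x` in `ℤ M_X`, for `x ≤ X`. -/
def intCellGen (x : W) (hx : x ∈ lowerSet cs φ σ X) : IntCellModule cs φ σ X :=
  intCellTmul cs φ σ X 1
    (Submodule.Quotient.mk ⟨Hecke.C cs φ x, Submodule.subset_span ⟨x, hx, rfl⟩⟩)

variable {cs φ σ X}

theorem intCellTmul_induction {p : IntCellModule cs φ σ X → Prop} (t : IntCellModule cs φ σ X)
    (h0 : p 0) (hadd : ∀ x y, p x → p y → p (x + y))
    (ht : ∀ n m, p (intCellTmul cs φ σ X n m)) : p t :=
  TensorProduct.induction_on (motive := p) t h0 (fun n => ht (augIntEquiv Γ n)) hadd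

theorem intCellTmul_smul (n : ℤ) (a : AddMonoidAlgebra ℤ Γ) (m : CellModule cs φ σ X) :
    intCellTmul cs φ σ X n (a • m) = a • intCellTmul cs φ σ X n m :=
  TensorProduct.tmul_smul a _ m

theorem intCellTmul_add (n : ℤ) (m m' : CellModule cs φ σ X) :
    intCellTmul cs φ σ X n (m + m') = intCellTmul cs φ σ X n m + intCellTmul cs φ σ X n m' :=
  TensorProduct.tmul_add _ _ _

theorem add_intCellTmul (n n' : ℤ) (m : CellModule cs φ σ X) :
    intCellTmul cs φ σ X (n + n') m = intCellTmul cs φ σ X n m + intCellTmul cs φ σ X n' m := by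
  rw [intCellTmul, map_add]
  exact TensorProduct.add_tmul _ _ _

theorem intCellTmul_zero (n : ℤ) : intCellTmul cs φ σ X n 0 = 0 := TensorProduct.tmul_zero _ _

theorem smul_intCellTmul (a : AddMonoidAlgebra ℤ Γ) (n : ℤ) (m : CellModule cs φ σ X) :
    a • intCellTmul cs φ σ X n m = intCellTmul cs φ σ X (aug Γ a * n) m :=
  TensorProduct.smul_tmul' a _ m

theorem zsmul_intCellTmul (k n : ℤ) (m : CellModule cs φ σ X) :
    k • intCellTmul cs φ σ X n m = intCellTmul cs φ σ X (k * n) m :=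
  (map_zsmul (AddMonoidHom.mk' (fun n => intCellTmul cs φ σ X n m)
    fun a b => add_intCellTmul a b m) k n).symm

/-- On a pure tensor the scalar can be moved to the factor `ℤ`, where it acts through the
augmentation. Consequently additive maps out of `ℤ M_X` need no linearity over `ℤ[Γ]`. -/
theorem smul_eq_aug_smul (a : AddMonoidAlgebra ℤ Γ) (t : IntCellModule cs φ σ X) :
    a • t = aug Γ a • t := by
  induction t using intCellTmul_induction with
  | h0 => rw [smul_zero, smul_zero]
  | hadd x y hx hy => rw [smul_add, smul_add, hx, hy]
  | ht n m => rw [smul_intCellTmul, zsmul_intCellTmul]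

/-- The classes `1 ⊗ C_x` with `x ≤ X` generate `ℤ M_X` already as an abelian group. -/
theorem intCell_hom_ext {A : Type*} [AddCommGroup A] {f g : IntCellModule cs φ σ X →+ A}
    (h : ∀ x hx, f (intCellGen cs φ σ X x hx) = g (intCellGen cs φ σ X x hx)) : f = g := by
  ext t
  induction t using intCellTmul_induction with
  | h0 => rw [map_zero, map_zero]
  | hadd x y hx hy => rw [map_add, map_add, hx, hy]
  | ht n m =>
    -- Write `n ⊗ m = n (1 ⊗ m)`, so that only the tensors `1 ⊗ m` remain.
    rw [← mul_one n, ← zsmul_intCellTmul, map_zsmul, map_zsmul]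
    congr 1
    obtain ⟨⟨m, hm⟩, rfl⟩ := Submodule.Quotient.mk_surjective _ m
    induction hm using Submodule.span_induction with
    | mem y hy =>
      obtain ⟨x, hx, rfl⟩ := hy
      exact h x hx
    | zero =>
      have : intCellTmul cs φ σ X 1 (Submodule.Quotient.mk ⟨0, zero_mem _⟩) = 0 :=
        intCellTmul_zero 1
      rw [this, map_zero, map_zero]
    | add y z hy hz ihy ihz =>
      have : intCellTmul cs φ σ X 1 (Submodule.Quotient.mk ⟨y + z, add_mem hy hz⟩) =
          intCellTmul cs φ σ X 1 (Submodule.Quotient.mk ⟨y, hy⟩) +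
            intCellTmul cs φ σ X 1 (Submodule.Quotient.mk ⟨z, hz⟩) :=
        intCellTmul_add 1 (Submodule.Quotient.mk ⟨y, hy⟩) (Submodule.Quotient.mk ⟨z, hz⟩)
      rw [this, map_add, map_add, ihy, ihz]
    | smul a y hy ihy =>
      have : intCellTmul cs φ σ X 1
          (Submodule.Quotient.mk ⟨a • y, Submodule.smul_mem _ a hy⟩) =
          a • intCellTmul cs φ σ X 1 (Submodule.Quotient.mk ⟨y, hy⟩) :=
        intCellTmul_smul 1 a (Submodule.Quotient.mk ⟨y, hy⟩)
      -- The scalar of `ℤ[Γ]` is traded for the integer `aug Γ a`, with which the additive maps `f`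
      -- and `g` commute.
      rw [this, smul_eq_aug_smul, map_zsmul, map_zsmul, ihy]

variable (cs φ) in
/-- The map with `a C_x ↦ aug(a) v(x)`. -/
def augConstr {A : Type*} [AddCommGroup A] (v : W → A) : Hecke cs φ →ₛₗ[aug Γ] A where
  toFun k := ((Hecke.klBasis cs φ).repr k).sum fun x a => aug Γ a • v x
  map_add' k l := by
    rw [map_add, Finsupp.sum_add_index' (h := fun x a => aug Γ a • v x)]
    · simp
    · intro x a b; rw [map_add, add_smul]
  map_smul' a k := by
    rw [map_smul, Finsupp.sum_smul_index (fun x => by rw [map_zero, zero_smul]), Finsupp.smul_sum]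
    exact Finsupp.sum_congr fun x _ => by rw [map_mul, mul_smul]

theorem augConstr_C {A : Type*} [AddCommGroup A] (v : W → A) (x : W) :
    augConstr cs φ v (Hecke.C cs φ x) = v x := by
  change ((Hecke.klBasis cs φ).repr (Hecke.C cs φ x)).sum (fun x a => aug Γ a • v x) = _
  rw [← Hecke.klBasis_apply, Module.Basis.repr_self,
    Finsupp.sum_single_index (by rw [map_zero, zero_smul]), map_one, one_smul]

variable (cs φ σ X) in
/-- The morphism out of the cell module with `C_x ↦ v(x)`. -/
def cellLift {A : Type*} [AddCommGroup A] (v : W → A)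
    (hv : ∀ x ∈ strictLowerSet cs φ σ X, v x = 0) : CellModule cs φ σ X →ₛₗ[aug Γ] A :=
  Submodule.liftQ _ ((augConstr cs φ v).comp (spanC cs φ (lowerSet cs φ σ X)).subtype) <| by
    intro m hm
    -- The map descends to the quotient because it kills the spanning vectors `C_x`, `x < X`, of the
    -- denominator.
    have : spanC cs φ (strictLowerSet cs φ σ X) ≤ LinearMap.ker (augConstr cs φ v) := by
      refine Submodule.span_le.2 ?_
      rintro _ ⟨x, hx, rfl⟩
      exact (augConstr_C v x).trans (hv x hx)
    exact this hm

variable (cs φ σ X) in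
/-- The morphism out of `ℤ M_X` with `C_x ↦ v(x)`. -/
def intCellLift {A : Type*} [AddCommGroup A] (v : W → A)
    (hv : ∀ x ∈ strictLowerSet cs φ σ X, v x = 0) : IntCellModule cs φ σ X →+ A :=
  TensorProduct.liftAddHom
    ((AddMonoidHom.mk' (fun n : ℤ => n • (cellLift cs φ σ X v hv).toAddMonoidHom)
      fun a b => add_smul a b _).comp (augIntEquiv Γ).toAddMonoidHom) fun a n m => by
    -- The pairing `(n, m) ↦ n • cellLift m` is balanced: on either side `a` contributes the integer
    -- `aug Γ a`.
    change augIntEquiv Γ (a • n) • cellLift cs φ σ X v hv m =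
      augIntEquiv Γ n • cellLift cs φ σ X v hv (a • m)
    rw [(cellLift cs φ σ X v hv).map_smulₛₗ, smul_smul, mul_comm, augIntEquiv_smul]

theorem intCellLift_gen {A : Type*} [AddCommGroup A] (v : W → A)
    (hv : ∀ x ∈ strictLowerSet cs φ σ X, v x = 0) (x : W) (hx : x ∈ lowerSet cs φ σ X) :
    intCellLift cs φ σ X v hv (intCellGen cs φ σ X x hx) = v x := by
  change (1 : ℤ) • augConstr cs φ v (Hecke.C cs φ x) = v x
  rw [one_smul, augConstr_C]

theorem intCellGen_eq_zero (x : W) (hx : x ∈ lowerSet cs φ σ X)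
    (hx' : x ∈ strictLowerSet cs φ σ X) : intCellGen cs φ σ X x hx = 0 := by
  rw [intCellGen, (Submodule.Quotient.mk_eq_zero _).2]
  · exact intCellTmul_zero 1
  · exact Submodule.subset_span ⟨x, hx', rfl⟩

end IntCellGen

/-! ### Isomorphism of the specialised cell modules -/

section IntCellMap

variable {Γ Γ' : Type*} [AddCommGroup Γ] [AddCommGroup Γ'] [LinearOrder Γ] [LinearOrder Γ']
  [IsOrderedAddMonoid Γ] [IsOrderedAddMonoid Γ'] (ι : Γ →+ Γ')
  {B W : Type*} [Group W] {M : CoxeterMatrix B} (cs : CoxeterSystem M W)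
  {φ : SBar cs → Γ} {φ' : SBar cs → Γ'} (h : ∀ ω, ι (φ ω) = φ' ω) (hι : StrictMono ι)
  (σ : Side) (X : Set W)

/-- `Hecke.map` as a semilinear map. -/
def Hecke.mapₛₗ : Hecke cs φ →ₛₗ[expMap ι] Hecke cs φ' where
  __ := Hecke.map ι cs h
  map_smul' := Hecke.map_smul' ι cs h

include hι in
theorem map_mem_spanC (D : Set W) :
    ∀ k ∈ spanC cs φ D, Hecke.mapₛₗ ι cs h k ∈ spanC cs φ' D := by
  refine fun k hk => (Submodule.span_le (p := (spanC cs φ' D).comap (Hecke.mapₛₗ ι cs h))).2 ?_ hk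
  rintro _ ⟨x, hx, rfl⟩
  exact Submodule.subset_span ⟨x, hx, (Hecke.map_C ι cs h hι x).symm⟩

/-- The morphism of cell modules induced by `Hecke.map`. -/
def cellMap : CellModule cs φ σ X →ₛₗ[expMap ι] CellModule cs φ' σ X :=
  Submodule.mapQ _ _
    (((Hecke.mapₛₗ ι cs h).comp (spanC cs φ (lowerSet cs φ σ X)).subtype).codRestrict
      (spanC cs φ' (lowerSet cs φ' σ X)) fun k => by
        -- The target is defined with the preorder of `φ'`, which is the preorder of `φ`.
        rw [← lowerSet_map ι cs h hι]
        exact map_mem_spanC ι cs h hι _ _ k.2)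
    fun k hk => by
      change Hecke.mapₛₗ ι cs h k.1 ∈ spanC cs φ' (strictLowerSet cs φ' σ X)
      rw [← strictLowerSet_map ι cs h hι]
      exact map_mem_spanC ι cs h hι _ _ hk

/-- The morphism `ℤ M_X → ℤ M_X` induced by `Hecke.map`. -/
def intCellMap : IntCellModule cs φ σ X →+ IntCellModule cs φ' σ X :=
  TensorProduct.liftAddHom
    ((AddMonoidHom.mk' (fun n : ℤ => AddMonoidHom.mk'
        (fun m => intCellTmul cs φ' σ X n (cellMap ι cs h hι σ X m))
        fun m m' => by rw [map_add, intCellTmul_add])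
      fun a b => AddMonoidHom.ext fun m => add_intCellTmul _ _ _).comp
        (augIntEquiv Γ).toAddMonoidHom) fun a n m => by
    -- Balancedness is the compatibility `aug_expMap`: on the right `a` becomes `expMap ι a`, whose
    -- augmentation is that of `a`.
    change intCellTmul cs φ' σ X (augIntEquiv Γ (a • n)) (cellMap ι cs h hι σ X m) =
      intCellTmul cs φ' σ X (augIntEquiv Γ n) (cellMap ι cs h hι σ X (a • m))
    rw [(cellMap ι cs h hι σ X).map_smulₛₗ, intCellTmul_smul, smul_intCellTmul, aug_expMap, augIntEquiv_smul]

theorem intCellMap_tmul (n : ℤ) (m : CellModule cs φ σ X) :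
    intCellMap ι cs h hι σ X (intCellTmul cs φ σ X n m) =
      intCellTmul cs φ' σ X n (cellMap ι cs h hι σ X m) := rfl

theorem intCellMap_gen (x : W) (hx : x ∈ lowerSet cs φ σ X) :
    intCellMap ι cs h hι σ X (intCellGen cs φ σ X x hx) =
      intCellGen cs φ' σ X x (lowerSet_map ι cs h hι σ X ▸ hx) := by
  change intCellTmul cs φ' σ X 1 (Submodule.Quotient.mk ⟨Hecke.map ι cs h _, _⟩) = _
  rw [intCellGen]
  congr 3
  exact Hecke.map_C ι cs h hι x

open scoped Classical in
/-- The inverse of `intCellMap`. -/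
def intCellMapInv : IntCellModule cs φ' σ X →+ IntCellModule cs φ σ X :=
  intCellLift cs φ' σ X (fun x => if hx : x ∈ lowerSet cs φ σ X then intCellGen cs φ σ X x hx else 0)
    fun x hx => by
      rw [← strictLowerSet_map ι cs h hι] at hx
      split_ifs with hx'
      · exact intCellGen_eq_zero x hx' hx
      · rfl

theorem intCellMapInv_gen (x : W) (hx : x ∈ lowerSet cs φ' σ X)
    (hx' : x ∈ lowerSet cs φ σ X) :
    intCellMapInv ι cs h hι σ X (intCellGen cs φ' σ X x hx) = intCellGen cs φ σ X x hx' := by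
  rw [intCellMapInv, intCellLift_gen, dif_pos hx']

/-- The isomorphism between specialised cell modules induced by a change of weights. -/
def intCellEquiv : IntCellModule cs φ σ X ≃+ IntCellModule cs φ' σ X :=
  (intCellMap ι cs h hι σ X).toAddEquiv (intCellMapInv ι cs h hι σ X)
    (intCell_hom_ext fun x hx => by
      rw [AddMonoidHom.comp_apply, intCellMap_gen, intCellMapInv_gen _ _ _ _ _ _ _ _ hx]; rfl)
    (intCell_hom_ext fun x hx => by
      rw [AddMonoidHom.comp_apply, intCellMapInv_gen _ _ _ _ _ _ _ _
        (lowerSet_map ι cs h hι σ X ▸ hx), intCellMap_gen]; rfl)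

/-- By additivity it suffices to let `w ∈ W` act on a pure tensor. There `w` acts as `1 ⊗ T_w`, and
`Hecke.map` is multiplicative with `T_w ↦ T_w`. -/
theorem intCellMap_smul [σ.HasLeft] (a : MonoidAlgebra ℤ W) (t : IntCellModule cs φ σ X) :
    intCellMap ι cs h hι σ X (a • t) = a • intCellMap ι cs h hι σ X t := by
  induction a using MonoidAlgebra.induction_linear with
  | zero => rw [zero_smul, zero_smul, map_zero]
  | add a b ha hb => rw [add_smul, add_smul, map_add, ha, hb]
  | single w n =>
    have hs : MonoidAlgebra.single w n = n • MonoidAlgebra.single w (1 : ℤ) := by simp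
    rw [hs, smul_assoc, smul_assoc, map_zsmul]
    congr 1
    induction t using intCellTmul_induction with
    | h0 => rw [smul_zero, map_zero, smul_zero]
    | hadd x y hx hy => rw [smul_add, map_add, map_add, smul_add, hx, hy]
    | ht n m =>
      rw [intCellMap_tmul]
      refine (congrArg _ (single_smul cs φ σ X w ((augIntEquiv Γ).symm n) m)).trans
        (Eq.trans ?_ (single_smul cs φ' σ X w ((augIntEquiv Γ').symm n) (cellMap ι cs h hι σ X m)).symm)
      refine congrArg (intCellTmul cs φ' σ X n) ?_
      obtain ⟨m, rfl⟩ := Submodule.Quotient.mk_surjective _ m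
      refine congrArg Submodule.Quotient.mk (Subtype.ext ?_)
      change Hecke.map ι cs h (Hecke.T cs φ w * m.1) = Hecke.T cs φ' w * Hecke.map ι cs h m.1
      rw [map_mul, Hecke.map_T]

theorem intCellMap_op_smul [σ.HasRight] (a : (MonoidAlgebra ℤ W)ᵐᵒᵖ)
    (t : IntCellModule cs φ σ X) :
    intCellMap ι cs h hι σ X (a • t) = a • intCellMap ι cs h hι σ X t := by
  induction a using MulOpposite.rec' with | _ a
  induction a using MonoidAlgebra.induction_linear with
  | zero => rw [MulOpposite.op_zero, zero_smul, zero_smul, map_zero]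
  | add a b ha hb => rw [MulOpposite.op_add, add_smul, add_smul, map_add, ha, hb]
  | single w n =>
    have hs : MonoidAlgebra.single w n = n • MonoidAlgebra.single w (1 : ℤ) := by simp
    rw [hs, MulOpposite.op_smul, smul_assoc, smul_assoc, map_zsmul]
    congr 1
    induction t using intCellTmul_induction with
    | h0 => rw [smul_zero, map_zero, smul_zero]
    | hadd x y hx hy => rw [smul_add, map_add, map_add, smul_add, hx, hy]
    | ht n m =>
      rw [intCellMap_tmul]
      refine (congrArg _ (single_op_smul cs φ σ X w ((augIntEquiv Γ).symm n) m)).trans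
        (Eq.trans ?_ (single_op_smul cs φ' σ X w ((augIntEquiv Γ').symm n) (cellMap ι cs h hι σ X m)).symm)
      refine congrArg (intCellTmul cs φ' σ X n) ?_
      obtain ⟨m, rfl⟩ := Submodule.Quotient.mk_surjective _ m
      refine congrArg Submodule.Quotient.mk (Subtype.ext ?_)
      change Hecke.map ι cs h (m.1 * Hecke.T cs φ w) = Hecke.map ι cs h m.1 * Hecke.T cs φ' w
      rw [map_mul, Hecke.map_T]

theorem intCellEquiv_symm_smul [σ.HasLeft] (a : MonoidAlgebra ℤ W)
    (t : IntCellModule cs φ' σ X) : (intCellEquiv ι cs h hι σ X).symm (a • t) =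
      a • (intCellEquiv ι cs h hι σ X).symm t := by
  rw [AddEquiv.symm_apply_eq]
  refine Eq.trans ?_ (intCellMap_smul ι cs h hι σ X a _).symm
  exact congrArg _ ((intCellEquiv ι cs h hι σ X).apply_symm_apply t).symm

theorem intCellEquiv_symm_op_smul [σ.HasRight] (a : (MonoidAlgebra ℤ W)ᵐᵒᵖ)
    (t : IntCellModule cs φ' σ X) : (intCellEquiv ι cs h hι σ X).symm (a • t) =
      a • (intCellEquiv ι cs h hι σ X).symm t := by
  rw [AddEquiv.symm_apply_eq]
  refine Eq.trans ?_ (intCellMap_op_smul ι cs h hι σ X a _).symm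
  exact congrArg _ ((intCellEquiv ι cs h hι σ X).apply_symm_apply t).symm

end IntCellMap

/-! ### The ordered embedding of `Γ_X` into `Γ` -/

section QuoEmbedding

variable {S Γ : Type*} [AddCommGroup Γ] [LinearOrder Γ] [IsOrderedAddMonoid Γ] {φ : S → Γ}
  {X : PositiveSubset (S →₀ ℤ)} (hX : PositiveSubset.pos (extend φ) = X)

/-- The embedding `Γ_X → Γ` for `X = Pos(φ)`. -/
def quoHom : X.Quo →+ Γ :=
  QuotientAddGroup.lift X.core (extend φ) fun x hx => by
    subst hX
    -- Membership in `X ∩ (-X)` says that `extend φ x` is both `≥ 0` and `≤ 0`.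
    have h1 : 0 ≤ extend φ x := hx.1
    have h2 : 0 ≤ extend φ (-x) := hx.2
    rw [map_neg, Left.nonneg_neg_iff] at h2
    exact le_antisymm h2 h1

theorem quoHom_can (x : S →₀ ℤ) : quoHom hX (X.can x) = extend φ x := rfl

theorem quoHom_canWeight (s : S) : quoHom hX (canWeight X s) = φ s :=
  (quoHom_can hX _).trans (extend_single φ s)

/-- Monotone because `a ≤ b` provides a representative of `b - a` in `X`, on which `extend φ` is
non-negative. Injective because an `x` killed by `extend φ` lies in `X` together with `-x`. -/
theorem quoHom_strictMono : StrictMono (quoHom hX) := by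
  refine Monotone.strictMono_of_injective ?_ ?_
  · rintro a b ⟨x, hx, hab⟩
    rw [← sub_nonneg, ← map_sub, ← hab, quoHom_can]
    subst hX
    exact hx
  · refine (injective_iff_map_eq_zero _).2 fun a ha => ?_
    obtain ⟨x, rfl⟩ := X.can_surjective a
    rw [quoHom_can] at ha
    rw [X.can_eq_zero]
    subst hX
    exact ⟨ha.ge, by change 0 ≤ extend φ (-x); rw [map_neg, ha, neg_zero]⟩

end QuoEmbedding

end KLCells

end

theorem mainTheorem7 {B W : Type*} [Group W] {M : CoxeterMatrix B} (cs : CoxeterSystem M W)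
    {Γ : Type*} [AddCommGroup Γ] [LinearOrder Γ] [IsOrderedAddMonoid Γ] (φ : KLCells.SBar cs → Γ)
    (X : KLCells.PositiveSubset (KLCells.SBar cs →₀ ℤ))
    (hX : X = KLCells.PositiveSubset.pos (KLCells.extend φ)) :
    (∀ (σ : KLCells.Side) (x y : W),
      KLCells.klLE cs φ σ x y ↔ KLCells.klLE cs (KLCells.canWeight X) σ x y) ∧
    (∀ (σ : KLCells.Side) (x y : W),
      KLCells.klEquiv cs φ σ x y ↔ KLCells.klEquiv cs (KLCells.canWeight X) σ x y) ∧
    (∀ (σ : KLCells.Side) (w : W),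
      KLCells.klCell cs φ σ w = KLCells.klCell cs (KLCells.canWeight X) σ w) ∧
    (∀ (Γ' : Type*) [AddCommGroup Γ'] [LinearOrder Γ'] [IsOrderedAddMonoid Γ']
      (φ' : KLCells.SBar cs → Γ'), KLCells.PositiveSubset.pos (KLCells.extend φ') = X →
      ∀ σ : KLCells.Side,
        (∀ x y : W, KLCells.klLE cs φ' σ x y ↔ KLCells.klLE cs φ σ x y) ∧
        (∀ x y : W, KLCells.klEquiv cs φ' σ x y ↔ KLCells.klEquiv cs φ σ x y) ∧
        (∀ w : W, KLCells.klCell cs φ' σ w = KLCells.klCell cs φ σ w)) ∧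
    (∀ (w : W) (C : Set W), C = KLCells.klCell cs φ .L w →
      Nonempty (KLCells.IntCellModule cs φ .L C ≃ₗ[MonoidAlgebra ℤ W]
        KLCells.IntCellModule cs (KLCells.canWeight X) .L C)) ∧
    (∀ (w : W) (C : Set W), C = KLCells.klCell cs φ .R w →
      Nonempty (KLCells.IntCellModule cs φ .R C ≃ₗ[(MonoidAlgebra ℤ W)ᵐᵒᵖ]
        KLCells.IntCellModule cs (KLCells.canWeight X) .R C)) ∧
    (∀ (w : W) (C : Set W), C = KLCells.klCell cs φ .LR w →
      ∃ e : KLCells.IntCellModule cs φ .LR C ≃+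
          KLCells.IntCellModule cs (KLCells.canWeight X) .LR C,
        (∀ (a : MonoidAlgebra ℤ W) (m : KLCells.IntCellModule cs φ .LR C),
          e (a • m) = a • e m) ∧
        (∀ (a : (MonoidAlgebra ℤ W)ᵐᵒᵖ) (m : KLCells.IntCellModule cs φ .LR C),
          e (a • m) = a • e m)) := by
  have h := KLCells.quoHom_canWeight hX.symm
  have hι := KLCells.quoHom_strictMono hX.symm
  refine ⟨fun σ x y => (KLCells.klLE_map _ cs h hι σ x y).symm,
    fun σ x y => (KLCells.klEquiv_map _ cs h hι σ x y).symm,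
    fun σ w => (KLCells.klCell_map _ cs h hι σ w).symm, ?_, ?_, ?_, ?_⟩
  · intro Γ' _ _ _ φ' hX' σ
    -- The group `Γ_X` embeds in `Γ'` as well as in `Γ`, so both weights are compared with
    -- `canWeight X`.
    have h' := KLCells.quoHom_canWeight hX'
    have hι' := KLCells.quoHom_strictMono hX'
    exact ⟨fun x y => (KLCells.klLE_map _ cs h' hι' σ x y).symm.trans
        (KLCells.klLE_map _ cs h hι σ x y),
      fun x y => (KLCells.klEquiv_map _ cs h' hι' σ x y).symm.trans
        (KLCells.klEquiv_map _ cs h hι σ x y),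
      fun w => (KLCells.klCell_map _ cs h' hι' σ w).symm.trans
        (KLCells.klCell_map _ cs h hι σ w)⟩
  · intro w C _
    -- The embedding goes from `Γ_X` to `Γ`, hence `intCellEquiv` goes from `φ_X` to `φ` and its
    -- inverse is the map wanted.
    exact ⟨{ (KLCells.intCellEquiv _ cs h hι .L C).symm with
      map_smul' := KLCells.intCellEquiv_symm_smul _ cs h hι .L C }⟩
  · intro w C _
    exact ⟨{ (KLCells.intCellEquiv _ cs h hι .R C).symm with
      map_smul' := KLCells.intCellEquiv_symm_op_smul _ cs h hι .R C }⟩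
  · intro w C _
    exact ⟨(KLCells.intCellEquiv _ cs h hι .LR C).symm,
      KLCells.intCellEquiv_symm_smul _ cs h hι .LR C,
      KLCells.intCellEquiv_symm_op_smul _ cs h hι .LR C⟩
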